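/- Let $\Bbbk$ be a field, let $m\ge 1$, and let $\mathbb P^m=\operatorname{Proj}\Bbbk[x_0,\dots,x_m]$. Let $D=\sum_{i=0}^n\alpha_iD_i$ be a $\mathbb Q$-divisor on $\mathbb P^m$, where $D_0,\dots,D_n$ are distinct integral hypersurfaces, $D_i=V(f_i)$ with $f_i\in\Bbbk[x_0,\dots,x_m]$ generating the homogeneous prime ideal of $D_i$, and $\alpha_i=c_i/k_i\in\mathbb Q$ in lowest terms with $k_i\ge 1$ (coefficients $\alpha_i=0$, for which $k_i=1$, are allowed). Put $a_i=\deg D_i=\deg f_i$, $\ell_i=\operatorname{lcm}_{j\ne i}k_j$ and $\deg D=\sum_i\alpha_ia_i$. Assume that $\deg D>0$ and that $\{f_0,\dots,f_n\}$ contains $m+1$ linearly independent linear forms. Let $$R_D=\bigoplus_{d\ge 0}u^d\,H^0(\mathbb P^m,\lfloor dD\rfloor),\qquad \lfloor dD\rfloor=\sum_i\lfloor d\alpha_i\rfloor D_i,$$ where $H^0(\mathbb P^m,E)$ is the space of rational functions $g$ on $\mathbb P^m$ with $g=0$ or $\operatorname{div}g+E\ge 0$, and $u$ is a variable of degree $1$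 that records the grading. Put $N=\sum_{i=0}^n\ell_ia_i$. Then: 1. $R_D$ is generated as a $\Bbbk$-algebra by finitely many homogeneous elements of degree at most $N$. 2. The relations are generated in degrees at most $$B=\max\left(2N,\ \frac{\max_{0\le i\le n}a_i}{\deg D}+N\right).$$ That is, for every finite system $w_1,\dots,w_r$ of homogeneous generators of the $\Bbbk$-algebra $R_D$ whose degrees are at most $N$, the kernel of the map $\Bbbk[W_1,\dots,W_r]\to R_D$, $W_j\mapsto w_j$, where $W_j$ has the degree of $w_j$, is generated as an ideal by homogeneous elements of degree at most $B$. -/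

import Mathlib

open MvPolynomial

noncomputable section

namespace ProjDiv

attribute [local instance] MvPolynomial.gradedAlgebra

/-- The homogeneous coordinate ring `K[x_0, …, x_m]` of `ℙ^m`. -/
abbrev CoordRing (K : Type*) [Field K] (m : ℕ) : Type _ := MvPolynomial (Fin (m + 1)) K

/-- The field `K(x_0, …, x_m)`, which contains the function field of `ℙ^m`. -/
abbrev FracRing (K : Type*) [Field K] (m : ℕ) : Type _ := FractionRing (CoordRing K m)

/-! ### Prime divisors on `ℙ^m` -/

/-- An integral codimension one closed subscheme of `ℙ^m = Proj K[x_0, …, x_m]`, given by its generic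
point: a relevant homogeneous prime ideal of height one. -/
structure PrimeDivisor (K : Type*) [Field K] (m : ℕ) where
  point : ProjectiveSpectrum (homogeneousSubmodule (Fin (m + 1)) K)
  height_eq_one : point.asHomogeneousIdeal.toIdeal.height = 1

namespace PrimeDivisor

variable {K : Type*} [Field K] {m : ℕ}

/-- The homogeneous prime ideal of a prime divisor. -/
def ideal (P : PrimeDivisor K m) : Ideal (CoordRing K m) := P.point.asHomogeneousIdeal.toIdeal

/-- `P = V(f)`: the polynomial `f` generates the homogeneous ideal of `P`. -/
def IsDefinedBy (P : PrimeDivisor K m) (f : CoordRing K m) : Prop := P.ideal = Ideal.span {f}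

instance (P : PrimeDivisor K m) : P.ideal.IsPrime := P.point.isPrime

theorem exists_isDefinedBy (P : PrimeDivisor K m) : ∃ f, P.IsDefinedBy f := by
  have h : P.ideal.IsPrincipal :=
    UniqueFactorizationMonoid.isPrincipal_of_height_eq_one P.height_eq_one
  exact h.principal

/-- A defining equation of `P`, unique up to a nonzero scalar. -/
def equation (P : PrimeDivisor K m) : CoordRing K m := P.exists_isDefinedBy.choose

theorem isDefinedBy_equation (P : PrimeDivisor K m) : P.IsDefinedBy P.equation :=
  P.exists_isDefinedBy.choose_spec

theorem IsDefinedBy.prime {P : PrimeDivisor K m} {f : CoordRing K m} (h : P.IsDefinedBy f) :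
    Prime f := by
  have h0 : f ≠ 0 := by
    rintro rfl
    have h1 : P.ideal.height = 1 := P.height_eq_one
    rw [h, Ideal.span_singleton_eq_bot.2 rfl, Ideal.height_bot] at h1
    exact zero_ne_one h1
  rw [← Ideal.span_singleton_prime h0, ← h]
  infer_instance

theorem IsDefinedBy.associated {P : PrimeDivisor K m} {f : CoordRing K m} (h : P.IsDefinedBy f) :
    Associated P.equation f := by
  rw [← Ideal.span_singleton_eq_span_singleton, ← h, P.isDefinedBy_equation]

/-- The degree of a prime divisor: the degree of a defining equation. -/
def degree (P : PrimeDivisor K m) : ℕ := P.equation.totalDegree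

/-- The order of vanishing along `P` of a rational function `g = a / b`: the multiplicity of the
equation of `P` in `a` minus its multiplicity in `b` (only used for `g ≠ 0`; it does not depend
on the choice of `a` and `b`, see `ord_div`). -/
def ord (P : PrimeDivisor K m) (g : FracRing K m) : ℤ :=
  (multiplicity P.equation (IsFractionRing.num (CoordRing K m) g) : ℤ) -
    (multiplicity P.equation (IsFractionRing.den (CoordRing K m) g : CoordRing K m) : ℤ)

theorem finiteMultiplicity (P : PrimeDivisor K m) {a : CoordRing K m} (ha : a ≠ 0) :
    FiniteMultiplicity P.equation a :=
  FiniteMultiplicity.of_not_isUnit P.isDefinedBy_equation.prime.not_isUnit ha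

theorem multiplicity_mul' (P : PrimeDivisor K m) {a b : CoordRing K m} (ha : a ≠ 0) (hb : b ≠ 0) :
    multiplicity P.equation (a * b) = multiplicity P.equation a + multiplicity P.equation b :=
  multiplicity_mul P.isDefinedBy_equation.prime (P.finiteMultiplicity (mul_ne_zero ha hb))

theorem ord_div (P : PrimeDivisor K m) {a b : CoordRing K m} (ha : a ≠ 0) (hb : b ≠ 0) :
    P.ord (algebraMap _ (FracRing K m) a / algebraMap _ (FracRing K m) b) =
      (multiplicity P.equation a : ℤ) - multiplicity P.equation b := by
  have hinj := IsFractionRing.injective (CoordRing K m) (FracRing K m)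
  have hb' : algebraMap _ (FracRing K m) b ≠ 0 := by simpa using hb
  have ha' : algebraMap _ (FracRing K m) a ≠ 0 := by simpa using ha
  set g := algebraMap _ (FracRing K m) a / algebraMap _ (FracRing K m) b with hg
  set p := IsFractionRing.num (CoordRing K m) g with hp
  set q : CoordRing K m := (IsFractionRing.den (CoordRing K m) g : CoordRing K m) with hq
  have hq0 : q ≠ 0 := nonZeroDivisors.coe_ne_zero _
  have hq' : algebraMap _ (FracRing K m) q ≠ 0 := by simpa using hq0
  have hpq : algebraMap _ (FracRing K m) p / algebraMap _ (FracRing K m) q = g := by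
    have := IsFractionRing.mk'_num_den (CoordRing K m) g
    rwa [IsFractionRing.mk'_eq_div] at this
  have hcross : p * b = a * q := by
    apply hinj
    rw [map_mul, map_mul]
    rwa [hg, div_eq_div_iff hq' hb'] at hpq
  have hp0 : p ≠ 0 := by
    intro h
    rw [h, zero_mul] at hcross
    exact mul_ne_zero ha hq0 hcross.symm
  have h1 := P.multiplicity_mul' hp0 hb
  rw [hcross, P.multiplicity_mul' ha hq0] at h1
  simp only [ord]
  rw [← hp, ← hq]
  omega

theorem exists_div (g : FracRing K m) (hg : g ≠ 0) : ∃ a b : CoordRing K m, a ≠ 0 ∧ b ≠ 0 ∧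
    g = algebraMap _ (FracRing K m) a / algebraMap _ (FracRing K m) b := by
  obtain ⟨a, b, hb, rfl⟩ := IsFractionRing.div_surjective (A := CoordRing K m) g
  refine ⟨a, b, ?_, nonZeroDivisors.ne_zero hb, rfl⟩
  rintro rfl
  simp at hg

theorem ord_mul (P : PrimeDivisor K m) {g h : FracRing K m} (hg : g ≠ 0) (hh : h ≠ 0) :
    P.ord (g * h) = P.ord g + P.ord h := by
  obtain ⟨a, b, ha, hb, rfl⟩ := exists_div g hg
  obtain ⟨c, d, hc, hd, rfl⟩ := exists_div h hh
  rw [div_mul_div_comm, ← map_mul, ← map_mul, P.ord_div (mul_ne_zero ha hc) (mul_ne_zero hb hd),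
    P.ord_div ha hb, P.ord_div hc hd, P.multiplicity_mul' ha hc, P.multiplicity_mul' hb hd]
  push_cast
  ring

theorem le_ord_add (P : PrimeDivisor K m) {g h : FracRing K m} (hg : g ≠ 0) (hh : h ≠ 0)
    (hgh : g + h ≠ 0) {k : ℤ} (h1 : k ≤ P.ord g) (h2 : k ≤ P.ord h) : k ≤ P.ord (g + h) := by
  obtain ⟨a, b, ha, hb, rfl⟩ := exists_div g hg
  obtain ⟨c, d, hc, hd, rfl⟩ := exists_div h hh
  have hb' : algebraMap _ (FracRing K m) b ≠ 0 := by simpa using hb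
  have hd' : algebraMap _ (FracRing K m) d ≠ 0 := by simpa using hd
  rw [div_add_div _ _ hb' hd', ← map_mul, ← map_mul, ← map_mul, ← map_add] at hgh ⊢
  have hs : a * d + b * c ≠ 0 := by
    intro h0
    rw [h0] at hgh
    simp at hgh
  rw [P.ord_div ha hb] at h1
  rw [P.ord_div hc hd] at h2
  rw [P.ord_div hs (mul_ne_zero hb hd), P.multiplicity_mul' hb hd]
  have h3 := min_le_emultiplicity_add (p := P.equation) (a := a * d) (b := b * c)
  rw [(P.finiteMultiplicity hs).emultiplicity_eq_multiplicity,
    (P.finiteMultiplicity (mul_ne_zero ha hd)).emultiplicity_eq_multiplicity,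
    (P.finiteMultiplicity (mul_ne_zero hb hc)).emultiplicity_eq_multiplicity,
    P.multiplicity_mul' ha hd, P.multiplicity_mul' hb hc, min_le_iff, Nat.cast_le,
    Nat.cast_le] at h3
  omega

theorem ord_algebraMap (P : PrimeDivisor K m) {c : K} (hc : c ≠ 0) :
    P.ord (algebraMap K (FracRing K m) c) = 0 := by
  have hC : (C c : CoordRing K m) ≠ 0 := by simpa using hc
  have h := P.ord_div hC one_ne_zero
  rw [map_one, div_one, ← MvPolynomial.algebraMap_eq,
    ← IsScalarTower.algebraMap_apply K (CoordRing K m) (FracRing K m)] at h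
  have hu : IsUnit (algebraMap K (CoordRing K m) c) := (Ne.isUnit hc).map _
  rw [h, multiplicity_of_isUnit_right P.isDefinedBy_equation.prime.not_isUnit hu,
    multiplicity_of_one_right P.isDefinedBy_equation.prime.not_isUnit, sub_self]

end PrimeDivisor

/-! ### Divisors and rational divisors -/

/-- Integral Weil divisors on `ℙ^m`. -/
abbrev Divisor (K : Type*) [Field K] (m : ℕ) : Type _ := PrimeDivisor K m →₀ ℤ

/-- Weil `ℚ`-divisors on `ℙ^m`. -/
abbrev QDivisor (K : Type*) [Field K] (m : ℕ) : Type _ := PrimeDivisor K m →₀ ℚ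

section

variable {K : Type*} [Field K] {m : ℕ}

/-- `deg (∑ α_i D_i) = ∑ α_i deg D_i`. -/
def QDivisor.degree (D : QDivisor K m) : ℚ := D.sum fun P α => α * (P.degree : ℚ)

/-- `⌊∑ α_i D_i⌋ = ∑ ⌊α_i⌋ D_i`. -/
def QDivisor.floor (D : QDivisor K m) : Divisor K m := D.mapRange Int.floor Int.floor_zero

/-- The function field of `ℙ^m`: fractions `a / b` of homogeneous polynomials of the same degree. -/
def functionField (K : Type*) [Field K] (m : ℕ) : IntermediateField K (FracRing K m) where
  carrier := {g | ∃ (e : ℕ) (a b : CoordRing K m), a.IsHomogeneous e ∧ b.IsHomogeneous e ∧ b ≠ 0 ∧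
    g = algebraMap _ (FracRing K m) a / algebraMap _ (FracRing K m) b}
  mul_mem' := by
    rintro _ _ ⟨e, a, b, ha, hb, hb0, rfl⟩ ⟨e', a', b', ha', hb', hb0', rfl⟩
    exact ⟨e + e', a * a', b * b', ha.mul ha', hb.mul hb', mul_ne_zero hb0 hb0', by
      rw [div_mul_div_comm, map_mul, map_mul]⟩
  add_mem' := by
    rintro _ _ ⟨e, a, b, ha, hb, hb0, rfl⟩ ⟨e', a', b', ha', hb', hb0', rfl⟩
    refine ⟨e + e', a * b' + b * a', b * b', (ha.mul hb').add (hb.mul ha'), hb.mul hb',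
      mul_ne_zero hb0 hb0', ?_⟩
    rw [div_add_div _ _ (by simpa using hb0) (by simpa using hb0')]
    simp only [map_mul, map_add]
  algebraMap_mem' c := by
    refine ⟨0, C c, 1, isHomogeneous_C _ c, isHomogeneous_one _ _, one_ne_zero, ?_⟩
    rw [map_one, div_one, ← MvPolynomial.algebraMap_eq,
      ← IsScalarTower.algebraMap_apply K (CoordRing K m) (FracRing K m)]
  inv_mem' := by
    rintro _ ⟨e, a, b, ha, hb, hb0, rfl⟩
    by_cases ha0 : a = 0
    · exact ⟨0, 0, 1, isHomogeneous_zero _ _ _, isHomogeneous_one _ _, one_ne_zero, by simp [ha0]⟩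
    · exact ⟨e, b, a, hb, ha, ha0, by rw [inv_div]⟩

/-- `H⁰(ℙ^m, 𝒪(E))`: the rational functions `g` with `g = 0` or `div g + E ≥ 0`. -/
def H0 (E : Divisor K m) : Submodule K (FracRing K m) where
  carrier := {g | g ∈ functionField K m ∧ (g ≠ 0 → ∀ P : PrimeDivisor K m, 0 ≤ P.ord g + E P)}
  zero_mem' := ⟨zero_mem _, fun h => absurd rfl h⟩
  add_mem' := by
    rintro g h ⟨hg, hg'⟩ ⟨hh, hh'⟩
    refine ⟨add_mem hg hh, fun hne P => ?_⟩
    by_cases g0 : g = 0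
    · subst g0
      rw [zero_add] at hne ⊢
      exact hh' hne P
    by_cases h0 : h = 0
    · subst h0
      rw [add_zero] at hne ⊢
      exact hg' hne P
    have := P.le_ord_add g0 h0 hne (k := -E P) (by linarith [hg' g0 P]) (by linarith [hh' h0 P])
    linarith
  smul_mem' := by
    rintro c g ⟨hg, hg'⟩
    refine ⟨(functionField K m).smul_mem hg, fun hne P => ?_⟩
    rw [Algebra.smul_def] at hne ⊢
    have hc : c ≠ 0 := by
      rintro rfl
      simp at hne
    rw [P.ord_mul (left_ne_zero_of_mul hne) (right_ne_zero_of_mul hne), P.ord_algebraMap hc,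
      zero_add]
    exact hg' (right_ne_zero_of_mul hne) P

theorem H0_mul_mem (D : QDivisor K m) {d e : ℕ} {g h : FracRing K m}
    (hg : g ∈ H0 ((d : ℚ) • D).floor) (hh : h ∈ H0 ((e : ℚ) • D).floor) :
    g * h ∈ H0 (((d + e : ℕ) : ℚ) • D).floor := by
  refine ⟨mul_mem hg.1 hh.1, fun hne P => ?_⟩
  have g0 := left_ne_zero_of_mul hne
  have h0 := right_ne_zero_of_mul hne
  have h1 := hg.2 g0 P
  have h2 := hh.2 h0 P
  rw [P.ord_mul g0 h0]
  have h3 : ⌊(d : ℚ) * D P⌋ + ⌊(e : ℚ) * D P⌋ ≤ ⌊((d + e : ℕ) : ℚ) * D P⌋ := by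
    rw [Nat.cast_add, add_mul]
    exact Int.le_floor_add _ _
  simp only [QDivisor.floor, Finsupp.mapRange_apply, Finsupp.smul_apply, smul_eq_mul] at h1 h2 ⊢
  linarith

theorem H0_algebraMap_mem (D : QDivisor K m) (c : K) :
    algebraMap K (FracRing K m) c ∈ H0 (((0 : ℕ) : ℚ) • D).floor := by
  refine ⟨(functionField K m).algebraMap_mem c, fun hne P => ?_⟩
  have hc : c ≠ 0 := by
    rintro rfl
    simp at hne
  rw [P.ord_algebraMap hc]
  simp [QDivisor.floor]

/-- The generalized canonical ring `R_D = ⨁_{d ≥ 0} u^d H⁰(ℙ^m, ⌊d D⌋)`, as a ring of polynomials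
in `u` whose coefficients are rational functions. -/
def canonicalRing (D : QDivisor K m) : Subalgebra K (Polynomial (FracRing K m)) where
  carrier := {p | ∀ d : ℕ, p.coeff d ∈ H0 ((d : ℚ) • D).floor}
  mul_mem' := by
    intro p q hp hq d
    rw [Polynomial.coeff_mul]
    refine Submodule.sum_mem _ fun x hx => ?_
    have hx' : x.1 + x.2 = d := by simpa using hx
    rw [← hx']
    exact H0_mul_mem D (hp _) (hq _)
  add_mem' := by
    intro p q hp hq d
    rw [Polynomial.coeff_add]
    exact add_mem (hp d) (hq d)
  algebraMap_mem' := by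
    intro c d
    rw [Polynomial.algebraMap_apply, Polynomial.coeff_C]
    split_ifs with h
    · subst h
      exact H0_algebraMap_mem D c
    · exact zero_mem _

/-- The graded piece `(R_D)_d = u^d H⁰(ℙ^m, ⌊d D⌋)`. -/
def canonicalRing.component (D : QDivisor K m) (d : ℕ) : Submodule K (canonicalRing D) where
  carrier := {x | ∀ e : ℕ, e ≠ d → (x : Polynomial (FracRing K m)).coeff e = 0}
  zero_mem' := fun e _ => by simp
  add_mem' := by
    intro x y hx hy e he
    simp [hx e he, hy e he]
  smul_mem' := by
    intro c x hx e he
    simp [hx e he]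

end

/-! ### Degrees of generators and relations of a graded algebra -/

section

variable {K R : Type*} [Field K] [CommRing R] [Algebra K R]

/-- The elements `w_1, …, w_r` are homogeneous of degrees `deg_1, …, deg_r` for the grading `𝒜` and
generate `R` as a `K`-algebra. -/
def IsHomogeneousGeneratingSystem (𝒜 : ℕ → Submodule K R) {r : ℕ} (deg : Fin r → ℕ)
    (w : Fin r → R) : Prop :=
  (∀ j, w j ∈ 𝒜 (deg j)) ∧ Algebra.adjoin K (Set.range w) = ⊤

/-- The ideal of relations among `w_1, …, w_r`, i.e. the kernel of `K[w_1, …, w_r] → R`, where the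
`j`-th variable has degree `deg_j`, is generated by homogeneous elements of degree at most `B`. -/
def RelationsGeneratedInDegreesLE {r : ℕ} (deg : Fin r → ℕ) (w : Fin r → R) (B : ℚ) : Prop :=
  RingHom.ker (aeval w : MvPolynomial (Fin r) K →ₐ[K] R) =
    Ideal.span {p | aeval w p = 0 ∧ ∃ e : ℕ, (e : ℚ) ≤ B ∧ IsWeightedHomogeneous deg p e}

end

end ProjDiv

end

/-! Multiplying by `∏ f_i ^ ⌊d α_i⌋` clears the poles of an element of `H⁰(⌊dD⌋)` and leaves a form
of degree `∑ ⌊d α_i⌋ a_i`. Since the `f_i` contain a basis of the linear forms, that form is a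
polynomial in the `f_i` (`exists_of_mem_H0`, `exists_section`). Hence `R_D` is spanned by the
monomials `u ^ d ∏ f_i ^ c_i` with all slacks `c_i + d α_i ≥ 0` and `∑ c_i a_i = 0`, the lattice
points of a cone. On it `∑ slack_i a_i = d deg D`, so the slacks are coordinates and the cone is
simplicial. Its `i`-th ray contains a lattice point of degree `ℓ_i a_i` and slack `ℓ_i deg D`.

Generators: subtracting rays as often as possible leaves a point with every `slack_i < ℓ_i deg D`,
hence of degree at most `∑ ℓ_i a_i = N` (`RaySystem.exists_rem`). The rays have degree at most `N`
too.

Relations come from two sources. The first is multiplication of monomials. If the lift of a monomial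
to the polynomial ring is chosen as lift of the remainder times powers of lifts of rays,
multiplicativity only has to be imposed on pairs of remainders, in degree at most `2N` (`cls_add`).
The second is linear dependence of the monomials of one degree. It is governed by the kernel of `y_i
↦ f_i`, which is generated by elements `y_i - φ(f_i)` of weight `a_i`, for a section `φ`. Multiplied
by an exponent vector of degree `d`, such an element gives a relation whose base point has `∑
slack_j a_j = d deg D - a_i`. If `d ≥ a_i / deg D + N`, some slack is at least `ℓ_j deg D`, so the
relation is a ray monomial times one of lower degree (`shiftSum_cls_eq_zero`). -/

namespace MvPolynomial

/-! ### Factors of homogeneous polynomials -/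

variable {σ R : Type*} [CommRing R]

/-- The substitution `X_i ↦ X_i T`, which records the grading by total degree. -/
noncomputable def scaleVars (σ R : Type*) [CommRing R] :
    MvPolynomial σ R →ₐ[R] Polynomial (MvPolynomial σ R) :=
  aeval fun i => Polynomial.C (X i) * Polynomial.X

theorem scaleVars_monomial (e : σ →₀ ℕ) (r : R) :
    scaleVars σ R (monomial e r) = Polynomial.C (monomial e r) * Polynomial.X ^ e.degree := by
  rw [scaleVars, aeval_monomial, monomial_eq, Finsupp.degree_apply]
  simp only [mul_pow, Finsupp.prod, Finset.prod_mul_distrib, map_mul, map_prod, map_pow,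
    Finset.prod_pow_eq_pow_sum, mul_assoc]
  rfl

theorem coeff_scaleVars (p : MvPolynomial σ R) (k : ℕ) :
    (scaleVars σ R p).coeff k = homogeneousComponent k p := by
  induction p using MvPolynomial.induction_on' with
  | monomial e r =>
    rw [scaleVars_monomial, Polynomial.coeff_C_mul_X_pow]
    split_ifs with h
    · exact (homogeneousComponent_eq_self (isHomogeneous_monomial r h.symm)).symm
    · exact ((homogeneousComponent_of_mem (isHomogeneous_monomial r rfl)).trans (if_neg h)).symm
  | add p q hp hq => rw [map_add, Polynomial.coeff_add, hp, hq, map_add]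

theorem scaleVars_injective : Function.Injective (scaleVars σ R) := by
  rw [injective_iff_map_eq_zero]
  intro p hp
  rw [← sum_homogeneousComponent p]
  exact Finset.sum_eq_zero fun k _ => by rw [← coeff_scaleVars, hp, Polynomial.coeff_zero]

theorem IsHomogeneous.scaleVars_eq {p : MvPolynomial σ R} {k : ℕ} (h : p.IsHomogeneous k) :
    scaleVars σ R p = Polynomial.C p * Polynomial.X ^ k := by
  ext1 j
  rw [coeff_scaleVars, Polynomial.coeff_C_mul_X_pow]
  exact homogeneousComponent_of_mem h

/-- A factor of a nonzero homogeneous polynomial over a domain is homogeneous. -/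
theorem IsHomogeneous.of_dvd [IsDomain R] {p q : MvPolynomial σ R} {k : ℕ}
    (hq : q.IsHomogeneous k) (hq0 : q ≠ 0) (h : p ∣ q) : p.IsHomogeneous p.totalDegree := by
  obtain ⟨r, rfl⟩ := h
  have hp0 := left_ne_zero_of_mul hq0
  have hr0 := right_ne_zero_of_mul hq0
  have hP : scaleVars σ R p ≠ 0 := (map_ne_zero_iff _ scaleVars_injective).2 hp0
  have hR : scaleVars σ R r ≠ 0 := (map_ne_zero_iff _ scaleVars_injective).2 hr0
  have h1 := hq.scaleVars_eq
  rw [map_mul] at h1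
  -- Over a domain the degree and the order in `T` are both additive. They agree for the product,
  -- hence for each factor.
  have h2 := Polynomial.natDegree_mul hP hR
  have h3 := Polynomial.natTrailingDegree_mul hP hR
  rw [h1, Polynomial.natDegree_C_mul_X_pow _ _ hq0] at h2
  rw [h1, Polynomial.C_mul_X_pow_eq_monomial, Polynomial.natTrailingDegree_monomial hq0] at h3
  have h4 := Polynomial.natTrailingDegree_le_natDegree (scaleVars σ R p)
  have h5 := Polynomial.natTrailingDegree_le_natDegree (scaleVars σ R r)
  have h6 : (scaleVars σ R p).natTrailingDegree = (scaleVars σ R p).natDegree := by omega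
  have h7 : p.IsHomogeneous (scaleVars σ R p).natDegree := by
    have h8 := IsHomogeneous.sum (Finset.range (p.totalDegree + 1))
      (fun j => homogeneousComponent j p) (scaleVars σ R p).natDegree fun j _ => ?_
    · rwa [sum_homogeneousComponent] at h8
    by_cases hj : j = (scaleVars σ R p).natDegree
    · rw [hj]
      exact homogeneousComponent_isHomogeneous _ _
    · rw [← coeff_scaleVars]
      have : (scaleVars σ R p).coeff j = 0 := by
        rcases lt_or_gt_of_ne hj with hj | hj
        · exact Polynomial.coeff_eq_zero_of_lt_natTrailingDegree (h6 ▸ hj)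
        · exact Polynomial.coeff_eq_zero_of_natDegree_lt hj
      rw [this]
      exact isHomogeneous_zero _ _ _
  rwa [h7.totalDegree hp0]

end MvPolynomial

/-! ### Equations of prime divisors and orders of vanishing -/

noncomputable section

namespace ProjDiv

attribute [local instance] MvPolynomial.gradedAlgebra

variable {K : Type*} [Field K] {m : ℕ}

namespace PrimeDivisor

theorem ideal_injective : Function.Injective (ideal : PrimeDivisor K m → _) := by
  rintro ⟨⟨I, h1, h2⟩, h3⟩ ⟨⟨J, h4, h5⟩, h6⟩ h
  have : I = J := HomogeneousIdeal.toIdeal_injective h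
  subst this
  rfl

/-- The ideal is homogeneous, so `f` divides each of its own components, one of which is nonzero; a
factor of a nonzero homogeneous polynomial is homogeneous. -/
theorem IsDefinedBy.isHomogeneous_totalDegree {P : PrimeDivisor K m} {f : CoordRing K m}
    (h : P.IsDefinedBy f) : f.IsHomogeneous f.totalDegree := by
  have hne : ∃ k, homogeneousComponent k f ≠ 0 := by
    by_contra! hk
    apply h.prime.ne_zero
    rw [← sum_homogeneousComponent f]
    exact Finset.sum_eq_zero fun k _ => hk k
  obtain ⟨k, hk⟩ := hne
  refine (homogeneousComponent_isHomogeneous k f).of_dvd hk ?_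
  rw [← Ideal.mem_span_singleton, ← h]
  have hf : f ∈ P.ideal := by rw [h]; exact Ideal.mem_span_singleton_self f
  have := P.point.asHomogeneousIdeal.isHomogeneous k hf
  rw [← decomposition.decompose'_apply]
  exact this

theorem IsDefinedBy.totalDegree_eq {P : PrimeDivisor K m} {f : CoordRing K m}
    (h : P.IsDefinedBy f) : f.totalDegree = P.degree := by
  obtain ⟨u, hu⟩ := h.associated
  obtain ⟨c, hc⟩ := MvPolynomial.isUnit_iff_eq_C_of_isReduced.1 u.isUnit
  have h0 : c ≠ 0 := hc.1.ne_zero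
  rw [← hu, hc.2, degree, totalDegree_mul_of_isDomain
    P.isDefinedBy_equation.prime.ne_zero (by simpa using h0), totalDegree_C, add_zero]

theorem IsDefinedBy.isHomogeneous {P : PrimeDivisor K m} {f : CoordRing K m}
    (h : P.IsDefinedBy f) : f.IsHomogeneous P.degree :=
  h.totalDegree_eq ▸ h.isHomogeneous_totalDegree

theorem degree_pos (P : PrimeDivisor K m) : 0 < P.degree := by
  rw [Nat.pos_iff_ne_zero]
  intro h
  have hp := P.isDefinedBy_equation.prime
  rw [degree, totalDegree_eq_zero_iff_eq_C] at h
  rw [h] at hp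
  refine hp.not_isUnit (IsUnit.map C (Ne.isUnit fun h0 => hp.ne_zero ?_))
  rw [h0, C_0]

/-- If some prime divisor is a hyperplane, every homogeneous prime polynomial defines a prime
divisor. -/
theorem exists_isDefinedBy_of_prime {P : PrimeDivisor K m} {f : CoordRing K m}
    (hf : P.IsDefinedBy f) (hf1 : f.IsHomogeneous 1) {p : CoordRing K m} (hp : Prime p)
    {k : ℕ} (hk : p.IsHomogeneous k) : ∃ Q : PrimeDivisor K m, Q.IsDefinedBy p := by
  have hI : (Ideal.span {p}).IsHomogeneous (homogeneousSubmodule (Fin (m + 1)) K) :=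
    Ideal.homogeneous_span _ _ (by rintro _ rfl; exact ⟨k, hk⟩)
  have hprime : (Ideal.span {p}).IsPrime := (Ideal.span_singleton_prime hp.ne_zero).2 hp
  refine ⟨⟨⟨⟨Ideal.span {p}, hI⟩, hprime, fun hle => ?_⟩, ?_⟩, rfl⟩
  -- If `(p)` contained the irrelevant ideal, `p` would divide the linear form `f` and `(p)` would
  -- be the ideal of `P`, which is relevant. The hyperplane `P` excludes `m = 0`, where `(x_0)` is a
  -- height one prime but irrelevant.
  · have hfp : p ∣ f := by
      rw [← Ideal.mem_span_singleton]
      apply hle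
      change f ∈ HomogeneousIdeal.irrelevant (homogeneousSubmodule (Fin (m + 1)) K)
      rw [HomogeneousIdeal.mem_irrelevant_iff]
      change ((decomposition.decompose' f) 0 : CoordRing K m) = 0
      rw [decomposition.decompose'_apply]
      exact (homogeneousComponent_of_mem hf1).trans (if_neg one_ne_zero.symm)
    have := (hp.associated_of_dvd hf.prime hfp)
    rw [← Ideal.span_singleton_eq_span_singleton, ← hf] at this
    refine P.point.not_irrelevant_le (hle.trans ?_)
    exact this.le
  · refine le_antisymm ?_ ?_
    · exact Ideal.height_le_one_of_isPrincipal_of_mem_minimalPrimes (Ideal.span {p}) _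
        (by rw [Ideal.minimalPrimes_eq_subsingleton_self]; rfl)
    · rw [Order.one_le_iff_ne_zero, Ne, Ideal.height_eq_zero_iff_eq_bot]
      exact fun h => hp.ne_zero (Ideal.span_singleton_eq_bot.1 h)

theorem ord_one (P : PrimeDivisor K m) : P.ord 1 = 0 := by
  have := P.ord_mul (one_ne_zero (α := FracRing K m)) one_ne_zero
  rw [one_mul] at this
  omega

theorem ord_inv (P : PrimeDivisor K m) {g : FracRing K m} (hg : g ≠ 0) :
    P.ord g⁻¹ = -P.ord g := by
  have := P.ord_mul hg (inv_ne_zero hg)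
  rw [mul_inv_cancel₀ hg, P.ord_one] at this
  omega

theorem ord_pow (P : PrimeDivisor K m) {g : FracRing K m} (hg : g ≠ 0) (k : ℕ) :
    P.ord (g ^ k) = k * P.ord g := by
  induction k with
  | zero => simp [ord_one]
  | succ k ih =>
    rw [pow_succ, P.ord_mul (pow_ne_zero _ hg) hg, ih]
    push_cast
    ring

theorem ord_zpow (P : PrimeDivisor K m) {g : FracRing K m} (hg : g ≠ 0) (k : ℤ) :
    P.ord (g ^ k) = k * P.ord g := by
  cases k with
  | ofNat k => simpa using P.ord_pow hg k
  | negSucc k =>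
    rw [zpow_negSucc, P.ord_inv (pow_ne_zero _ hg), P.ord_pow hg]
    push_cast [Int.negSucc_eq]
    ring

theorem ord_prod (P : PrimeDivisor K m) {ι : Type*} (s : Finset ι) {g : ι → FracRing K m}
    (hg : ∀ i ∈ s, g i ≠ 0) : P.ord (∏ i ∈ s, g i) = ∑ i ∈ s, P.ord (g i) := by
  classical
  induction s using Finset.induction_on with
  | empty => simp [ord_one]
  | insert i s hi ih =>
    rw [Finset.prod_insert hi, Finset.sum_insert hi, P.ord_mul (hg i (by simp)),
      ih fun j hj => hg j (by simp [hj])]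
    exact Finset.prod_ne_zero_iff.2 fun j hj => hg j (by simp [hj])

theorem IsDefinedBy.ord_eq [DecidableEq (PrimeDivisor K m)] {P : PrimeDivisor K m}
    {f : CoordRing K m} (h : P.IsDefinedBy f) (Q : PrimeDivisor K m) :
    Q.ord (algebraMap _ (FracRing K m) f) = if Q = P then 1 else 0 := by
  have hu := Q.isDefinedBy_equation.prime.not_isUnit
  have h1 := Q.ord_div h.prime.ne_zero (one_ne_zero (α := CoordRing K m))
  rw [map_one, div_one, multiplicity_of_one_right hu, Nat.cast_zero, sub_zero] at h1
  rw [h1]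
  split_ifs with hQ
  · subst hQ
    rw [multiplicity_eq_of_associated_left h.associated.symm]
    have := (FiniteMultiplicity.of_not_isUnit h.prime.not_isUnit h.prime.ne_zero)
    exact_mod_cast multiplicity_self (α := CoordRing K m) (a := f)
  · rw [Nat.cast_eq_zero, multiplicity_eq_zero]
    intro hdvd
    apply hQ
    apply ideal_injective
    rw [Q.isDefinedBy_equation, h, Ideal.span_singleton_eq_span_singleton]
    exact Q.isDefinedBy_equation.prime.associated_of_dvd h.prime hdvd

end PrimeDivisor

/-! ### Homogeneous fractions -/

/-- `g` is a quotient of two nonzero homogeneous polynomials whose degrees differ by `k`. -/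
def IsHomogeneousFraction (g : FracRing K m) (k : ℤ) : Prop :=
  ∃ (e e' : ℕ) (a b : CoordRing K m), a.IsHomogeneous e ∧ b.IsHomogeneous e' ∧ a ≠ 0 ∧ b ≠ 0 ∧
    (e : ℤ) = e' + k ∧ g = algebraMap _ (FracRing K m) a / algebraMap _ (FracRing K m) b

namespace IsHomogeneousFraction

variable {g h : FracRing K m} {k l : ℤ}

theorem ne_zero (hg : IsHomogeneousFraction g k) : g ≠ 0 := by
  obtain ⟨e, e', a, b, -, -, ha, hb, -, rfl⟩ := hg
  exact div_ne_zero (by simpa using ha) (by simpa using hb)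

theorem of_isHomogeneous {a : CoordRing K m} {e : ℕ} (ha : a.IsHomogeneous e) (h0 : a ≠ 0) :
    IsHomogeneousFraction (algebraMap _ (FracRing K m) a) e :=
  ⟨e, 0, a, 1, ha, isHomogeneous_one _ _, h0, one_ne_zero, by simp, by simp⟩

theorem one : IsHomogeneousFraction (1 : FracRing K m) 0 :=
  ⟨0, 0, 1, 1, isHomogeneous_one _ _, isHomogeneous_one _ _, one_ne_zero, one_ne_zero, by simp,
    by simp⟩

theorem mul (hg : IsHomogeneousFraction g k) (hh : IsHomogeneousFraction h l) :
    IsHomogeneousFraction (g * h) (k + l) := by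
  obtain ⟨e, e', a, b, ha, hb, ha0, hb0, he, rfl⟩ := hg
  obtain ⟨i, i', c, d, hc, hd, hc0, hd0, hi, rfl⟩ := hh
  refine ⟨e + i, e' + i', a * c, b * d, ha.mul hc, hb.mul hd, mul_ne_zero ha0 hc0,
    mul_ne_zero hb0 hd0, by push_cast; omega, ?_⟩
  rw [div_mul_div_comm, map_mul, map_mul]

theorem inv (hg : IsHomogeneousFraction g k) : IsHomogeneousFraction g⁻¹ (-k) := by
  obtain ⟨e, e', a, b, ha, hb, ha0, hb0, he, rfl⟩ := hg
  exact ⟨e', e, b, a, hb, ha, hb0, ha0, by omega, by rw [inv_div]⟩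

theorem pow (hg : IsHomogeneousFraction g k) (i : ℕ) : IsHomogeneousFraction (g ^ i) (i * k) := by
  induction i with
  | zero => simpa using one
  | succ i ih =>
    rw [pow_succ]
    convert ih.mul hg using 1
    push_cast
    ring

theorem zpow (hg : IsHomogeneousFraction g k) (i : ℤ) : IsHomogeneousFraction (g ^ i) (i * k) := by
  cases i with
  | ofNat i => simpa using hg.pow i
  | negSucc i =>
    rw [zpow_negSucc]
    convert (hg.pow (i + 1)).inv using 1
    push_cast [Int.negSucc_eq]
    ring

theorem prod {ι : Type*} (s : Finset ι) {g : ι → FracRing K m} {k : ι → ℤ}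
    (hg : ∀ i ∈ s, IsHomogeneousFraction (g i) (k i)) :
    IsHomogeneousFraction (∏ i ∈ s, g i) (∑ i ∈ s, k i) := by
  classical
  induction s using Finset.induction_on with
  | empty => simpa using one
  | insert i s hi ih =>
    rw [Finset.prod_insert hi, Finset.sum_insert hi]
    exact (hg i (by simp)).mul (ih fun j hj => hg j (by simp [hj]))

theorem mem_functionField (hg : IsHomogeneousFraction g 0) : g ∈ functionField K m := by
  obtain ⟨e, e', a, b, ha, hb, ha0, hb0, he, rfl⟩ := hg
  obtain rfl : e = e' := by omega
  exact ⟨e, a, b, ha, hb, hb0, rfl⟩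

theorem of_mem_functionField (hg : g ∈ functionField K m) (h0 : g ≠ 0) :
    IsHomogeneousFraction g 0 := by
  obtain ⟨e, a, b, ha, hb, hb0, rfl⟩ := hg
  refine ⟨e, e, a, b, ha, hb, ?_, hb0, by simp, rfl⟩
  rintro rfl
  simp at h0

/-- A homogeneous fraction without poles is a homogeneous polynomial. -/
theorem exists_eq_algebraMap {P : PrimeDivisor K m} {f : CoordRing K m}
    (hf : P.IsDefinedBy f) (hf1 : f.IsHomogeneous 1) (hg : IsHomogeneousFraction g k)
    (hord : ∀ Q : PrimeDivisor K m, 0 ≤ Q.ord g) :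
    ∃ (q : CoordRing K m) (e : ℕ), q.IsHomogeneous e ∧ (e : ℤ) = k ∧
      g = algebraMap _ (FracRing K m) q := by
  have g0 := hg.ne_zero
  obtain ⟨e, e', a, b, ha, hb, ha0, hb0, he, hgab⟩ := hg
  have hinj := IsFractionRing.injective (CoordRing K m) (FracRing K m)
  have hb' : algebraMap _ (FracRing K m) b ≠ 0 := by simpa using hb0
  set p := IsFractionRing.num (CoordRing K m) g with hp
  set q : CoordRing K m := (IsFractionRing.den (CoordRing K m) g : CoordRing K m) with hq
  have hq0 : q ≠ 0 := nonZeroDivisors.coe_ne_zero _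
  have hq' : algebraMap _ (FracRing K m) q ≠ 0 := by simpa using hq0
  have hpq : algebraMap _ (FracRing K m) p / algebraMap _ (FracRing K m) q = g := by
    have := IsFractionRing.mk'_num_den (CoordRing K m) g
    rwa [IsFractionRing.mk'_eq_div] at this
  have hred : IsRelPrime p q := IsFractionRing.num_den_reduced (CoordRing K m) g
  have hcross : p * b = a * q := by
    apply hinj
    rw [map_mul, map_mul]
    rwa [hgab, div_eq_div_iff hq' hb'] at hpq
  have hqb : q ∣ b := hred.symm.dvd_of_dvd_mul_left (hcross ▸ dvd_mul_left q a)
  -- An irreducible factor of the reduced denominator divides the homogeneous `b`, so it is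
  -- homogeneous and defines a prime divisor, along which `g` would have a pole.
  have hqu : IsUnit q := by
    by_contra hnu
    obtain ⟨r, hr, hrq⟩ := WfDvdMonoid.exists_irreducible_factor hnu hq0
    obtain ⟨Q, hQ⟩ := PrimeDivisor.exists_isDefinedBy_of_prime hf hf1 hr.prime
      (hb.of_dvd hb0 (hrq.trans hqb))
    have hass := hQ.associated
    have h1 : Q.equation ∣ q := hass.dvd.trans hrq
    have h2 : ¬ Q.equation ∣ p := fun h => Q.isDefinedBy_equation.prime.not_isUnit (hred h h1)
    have h3 := hord Q
    rw [PrimeDivisor.ord, ← hp, ← hq, multiplicity_eq_zero.2 h2] at h3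
    have h4 : multiplicity Q.equation q = 0 := by omega
    exact multiplicity_eq_zero.1 h4 h1
  obtain ⟨r, hr⟩ := hqu.exists_right_inv
  have hpa : (p * r) * b = a := by
    calc (p * r) * b = (p * b) * r := by ring
      _ = a * (q * r) := by rw [hcross]; ring
      _ = a := by rw [hr, mul_one]
  have hhom := ha.of_dvd ha0 (Dvd.intro _ hpa)
  have hdeg := (hpa ▸ hhom.mul hb).inj_right ha ha0
  refine ⟨p * r, _, hhom, by omega, ?_⟩
  rw [← hpq, div_eq_iff hq', ← map_mul, mul_assoc, mul_comm r, hr, mul_one]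

end IsHomogeneousFraction

end ProjDiv

end

/-! ### Monomials in the equations and the spaces of sections -/

noncomputable section

namespace ProjDiv

variable {K : Type*} [Field K] {m : ℕ}

theorem _root_.MvPolynomial.IsHomogeneous.isWeightedHomogeneous_aeval {R σ τ : Type*}
    [CommSemiring R] {p : MvPolynomial σ R} {e : ℕ} (hp : p.IsHomogeneous e) {a : τ → ℕ}
    {g : σ → MvPolynomial τ R} (hg : ∀ i, IsWeightedHomogeneous a (g i) 1) :
    IsWeightedHomogeneous a (aeval g p) e := by
  rw [aeval_def, eval₂_eq]
  refine IsWeightedHomogeneous.sum _ _ _ fun d hd => ?_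
  refine IsWeightedHomogeneous.C_mul ?_ _
  rw [hp.degree_eq_sum_deg_support hd]
  refine IsWeightedHomogeneous.prod _ _ _ fun i _ => ?_
  simpa using (hg i).pow (d i)

/-- If homogeneous polynomials `f_i` of degrees `a_i` contain a basis of the linear forms, then the
evaluation `y_i ↦ f_i` has a section that is compatible with the gradings. -/
theorem exists_section {ι : Type*} {a : ι → ℕ} {f : ι → CoordRing K m}
    {s : Fin (m + 1) → ι} (hs : ∀ j, (f (s j)).IsHomogeneous 1) (ha : ∀ j, a (s j) = 1)
    (hli : LinearIndependent K fun j => f (s j)) :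
    ∃ φ : CoordRing K m →ₐ[K] MvPolynomial ι K, (∀ h, aeval f (φ h) = h) ∧
      ∀ (h : CoordRing K m) (e : ℕ), h.IsHomogeneous e → IsWeightedHomogeneous a (φ h) e := by
  -- The `m + 1` independent linear forms span all linear forms, by dimension.
  have hspan : Submodule.span K (Set.range fun j => f (s j)) =
      Submodule.span K (Set.range (X : Fin (m + 1) → CoordRing K m)) := by
    have : FiniteDimensional K (Submodule.span K (Set.range (X : Fin (m + 1) → CoordRing K m))) :=
      FiniteDimensional.span_of_finite K (Set.finite_range _)
    apply Submodule.eq_of_le_of_finrank_eq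
    · rw [Submodule.span_le, ← homogeneousSubmodule_one_eq_span_X]
      rintro _ ⟨j, rfl⟩
      exact hs j
    · rw [finrank_span_eq_card hli, finrank_span_eq_card (linearIndependent_X _ _)]
  have hX : ∀ k : Fin (m + 1), ∃ c : Fin (m + 1) → K, ∑ j, c j • f (s j) = X k := by
    intro k
    rw [← Submodule.mem_span_range_iff_exists_fun, hspan]
    exact Submodule.subset_span ⟨k, rfl⟩
  choose c hc using hX
  -- The section rewrites each `x_k` in the variables `y_{s j}`, all of weight one, so a form of
  -- degree `e` becomes weighted homogeneous of weight `e`.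
  refine ⟨aeval fun k => ∑ j, c k j • X (s j), fun h => ?_, fun h e he => ?_⟩
  · have : (aeval f).comp (aeval fun k => ∑ j, c k j • (X (s j) : MvPolynomial ι K)) =
        AlgHom.id K (CoordRing K m) := by
      ext1 k
      simp [hc]
    exact DFunLike.congr_fun this h
  · refine he.isWeightedHomogeneous_aeval fun k => IsWeightedHomogeneous.sum _ _ _ fun j _ => ?_
    rw [smul_eq_C_mul]
    refine IsWeightedHomogeneous.C_mul ?_ _
    exact ha j ▸ isWeightedHomogeneous_X K a (s j)

variable {ι : Type*} [Fintype ι]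

/-- The rational function `∏ f_i ^ c_i`. -/
def monomialFraction (f : ι → CoordRing K m) (c : ι → ℤ) : FracRing K m :=
  ∏ i, algebraMap _ (FracRing K m) (f i) ^ c i

section

variable {P : ι → PrimeDivisor K m} {f : ι → CoordRing K m} (hf : ∀ i, (P i).IsDefinedBy (f i))
include hf

omit [Fintype ι] in
theorem algebraMap_ne_zero_of_isDefinedBy (i : ι) : algebraMap _ (FracRing K m) (f i) ≠ 0 := by
  simpa using (hf i).prime.ne_zero

theorem monomialFraction_ne_zero (c : ι → ℤ) : monomialFraction f c ≠ 0 :=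
  Finset.prod_ne_zero_iff.2 fun i _ => zpow_ne_zero _ (algebraMap_ne_zero_of_isDefinedBy hf i)

theorem monomialFraction_add (c d : ι → ℤ) :
    monomialFraction f (c + d) = monomialFraction f c * monomialFraction f d := by
  simp only [monomialFraction, ← Finset.prod_mul_distrib, Pi.add_apply]
  exact Finset.prod_congr rfl fun i _ => zpow_add₀ (algebraMap_ne_zero_of_isDefinedBy hf i) _ _

theorem isHomogeneousFraction_monomialFraction (c : ι → ℤ) :
    IsHomogeneousFraction (monomialFraction f c) (∑ i, c i * (P i).degree) :=
  IsHomogeneousFraction.prod _ fun i _ =>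
    (IsHomogeneousFraction.of_isHomogeneous (hf i).isHomogeneous (hf i).prime.ne_zero).zpow (c i)

theorem ord_monomialFraction [DecidableEq (PrimeDivisor K m)] (c : ι → ℤ) (Q : PrimeDivisor K m) :
    Q.ord (monomialFraction f c) = ∑ i, if Q = P i then c i else 0 := by
  rw [monomialFraction,
    Q.ord_prod _ fun i _ => zpow_ne_zero _ (algebraMap_ne_zero_of_isDefinedBy hf i)]
  refine Finset.sum_congr rfl fun i _ => ?_
  rw [Q.ord_zpow (algebraMap_ne_zero_of_isDefinedBy hf i), (hf i).ord_eq]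
  split_ifs <;> simp

theorem ord_monomialFraction_self (hP : Function.Injective P) (c : ι → ℤ) (i : ι) :
    (P i).ord (monomialFraction f c) = c i := by
  classical
  rw [ord_monomialFraction hf, Finset.sum_eq_single i]
  · simp
  · intro j _ hj
    rw [if_neg fun h => hj (hP h).symm]
  · simp

theorem ord_monomialFraction_of_notMem {Q : PrimeDivisor K m} (hQ : Q ∉ Set.range P) (c : ι → ℤ) :
    Q.ord (monomialFraction f c) = 0 := by
  classical
  rw [ord_monomialFraction hf]
  exact Finset.sum_eq_zero fun i _ => if_neg fun h => hQ ⟨i, h.symm⟩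

end

theorem monomialFraction_zero (f : ι → CoordRing K m) : monomialFraction f 0 = 1 := by
  simp [monomialFraction]

theorem monomialFraction_natCast (f : ι → CoordRing K m) (e : ι →₀ ℕ) :
    monomialFraction f (fun i => (e i : ℤ)) =
      algebraMap _ (FracRing K m) (aeval f (monomial e (1 : K))) := by
  rw [aeval_monomial, map_one, one_mul, Finsupp.prod_fintype _ _ (by simp), map_prod]
  simp [monomialFraction]

section

variable {P : ι → PrimeDivisor K m} {α : ι → ℚ} {D : QDivisor K m}
  (hD : D = ∑ i, Finsupp.single (P i) (α i))
include hD

theorem qDivisor_apply_self (hP : Function.Injective P) (i : ι) : D (P i) = α i := by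
  classical
  rw [hD, Finsupp.finsetSum_apply, Finset.sum_eq_single i]
  · simp
  · intro j _ hj
    rw [Finsupp.single_eq_of_ne fun h => hj (hP h).symm]
  · simp

theorem qDivisor_apply_of_notMem {Q : PrimeDivisor K m} (hQ : Q ∉ Set.range P) : D Q = 0 := by
  rw [hD, Finsupp.finsetSum_apply]
  refine Finset.sum_eq_zero fun i _ => Finsupp.single_eq_of_ne fun h => hQ ⟨i, h.symm⟩

theorem qDivisor_degree_eq : QDivisor.degree D = ∑ i, α i * (P i).degree := by
  classical
  rw [QDivisor.degree, hD, ← Finsupp.sum_finsetSum_index (by simp) (by intros; ring)]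
  simp

end

theorem floor_apply (D : QDivisor K m) (d : ℕ) (Q : PrimeDivisor K m) :
    ((d : ℚ) • D).floor Q = ⌊(d : ℚ) * D Q⌋ := by
  simp [QDivisor.floor]

section

variable {P : ι → PrimeDivisor K m} {f : ι → CoordRing K m} (hf : ∀ i, (P i).IsDefinedBy (f i))
  (hP : Function.Injective P) {α : ι → ℚ} {D : QDivisor K m}
  (hD : D = ∑ i, Finsupp.single (P i) (α i))
include hf hP hD

theorem monomialFraction_mem_H0 {d : ℕ} {c : ι → ℤ} (hc : ∀ i, 0 ≤ c i + d * α i)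
    (hsum : ∑ i, c i * ((P i).degree : ℤ) = 0) :
    monomialFraction f c ∈ H0 ((d : ℚ) • D).floor := by
  refine ⟨(hsum ▸ isHomogeneousFraction_monomialFraction hf c).mem_functionField, fun _ Q => ?_⟩
  rw [floor_apply]
  by_cases hQ : Q ∈ Set.range P
  · obtain ⟨i, rfl⟩ := hQ
    rw [ord_monomialFraction_self hf hP, qDivisor_apply_self hD hP]
    have : -c i ≤ ⌊(d : ℚ) * α i⌋ := by
      rw [Int.le_floor]
      push_cast
      linarith [hc i]
    linarith
  · rw [ord_monomialFraction_of_notMem hf hQ, qDivisor_apply_of_notMem hD hQ]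
    simp

/-- `H⁰(⌊d D⌋)` consists of the products of `∏ f_i ^ (-⌊d α_i⌋)` with homogeneous polynomials. -/
theorem exists_of_mem_H0 {i₀ : ι} (hi₀ : (f i₀).IsHomogeneous 1) {d : ℕ} {g : FracRing K m}
    (hg : g ∈ H0 ((d : ℚ) • D).floor) (hg0 : g ≠ 0) :
    ∃ (q : CoordRing K m) (e : ℕ), q.IsHomogeneous e ∧
      (e : ℤ) = ∑ i, ⌊d * α i⌋ * ((P i).degree : ℤ) ∧
      g = monomialFraction f (-fun i => ⌊d * α i⌋) * algebraMap _ (FracRing K m) q := by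
  -- The factor `∏ f_i ^ ⌊d α_i⌋` cancels every pole that `⌊dD⌋` allows, and the product has degree
  -- `deg ⌊dD⌋`.
  have hmul : IsHomogeneousFraction (monomialFraction f (fun i => ⌊d * α i⌋) * g)
      (∑ i, ⌊d * α i⌋ * ((P i).degree : ℤ)) := by
    simpa using (isHomogeneousFraction_monomialFraction hf fun i => ⌊d * α i⌋).mul
      (IsHomogeneousFraction.of_mem_functionField hg.1 hg0)
  obtain ⟨q, e, hq, he, heq⟩ := hmul.exists_eq_algebraMap (hf i₀) hi₀ fun Q => by
    rw [Q.ord_mul (monomialFraction_ne_zero hf _) hg0]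
    have hQ := hg.2 hg0 Q
    rw [floor_apply] at hQ
    by_cases h : Q ∈ Set.range P
    · obtain ⟨i, rfl⟩ := h
      rw [qDivisor_apply_self hD hP] at hQ
      rw [ord_monomialFraction_self hf hP]
      linarith
    · rw [qDivisor_apply_of_notMem hD h] at hQ
      rw [ord_monomialFraction_of_notMem hf h]
      simpa using hQ
  refine ⟨q, e, hq, he, ?_⟩
  rw [← heq, ← mul_assoc, ← monomialFraction_add hf, neg_add_cancel, monomialFraction_zero,
    one_mul]

end

end ProjDiv

end

/-! ### The cone of exponents -/

namespace ProjDiv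

variable {ι : Type*}

/-- The values `c_i + d α_i` of the facet functionals of the cone of a divisor at `(d, c)`. -/
def slack (α : ι → ℚ) (x : ℕ × (ι → ℤ)) (i : ι) : ℚ := x.2 i + x.1 * α i

theorem slack_add (α : ι → ℚ) (x y : ℕ × (ι → ℤ)) (i : ι) :
    slack α (x + y) i = slack α x i + slack α y i := by
  simp only [slack, Prod.snd_add, Prod.fst_add, Pi.add_apply]
  push_cast
  ring

theorem slack_zero (α : ι → ℚ) (i : ι) : slack α 0 i = 0 := by simp [slack]

theorem slack_nsmul (α : ι → ℚ) (k : ℕ) (x : ℕ × (ι → ℤ)) (i : ι) :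
    slack α (k • x) i = k * slack α x i := by
  change ((k • x.2 i : ℤ) : ℚ) + ((k • x.1 : ℕ) : ℚ) * α i = k * (x.2 i + x.1 * α i)
  simp only [nsmul_eq_mul, smul_eq_mul]
  push_cast
  ring

theorem slack_sum (α : ι → ℚ) {κ : Type*} (s : Finset κ) (x : κ → ℕ × (ι → ℤ)) (i : ι) :
    slack α (∑ k ∈ s, x k) i = ∑ k ∈ s, slack α (x k) i := by
  classical
  induction s using Finset.induction_on with
  | empty => simp [slack_zero]
  | insert k s hk ih => rw [Finset.sum_insert hk, Finset.sum_insert hk, slack_add, ih]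

/-- The lattice points on which all facet functionals are nonnegative. -/
def slackCone (α : ι → ℚ) : AddSubmonoid (ℕ × (ι → ℤ)) where
  carrier := {x | ∀ i, 0 ≤ slack α x i}
  zero_mem' i := (slack_zero α i).ge
  add_mem' hx hy i := slack_add α _ _ i ▸ add_nonneg (hx i) (hy i)

variable [Fintype ι]

/-- The exponents `(d, c)` of the monomials `u ^ d ∏ f_i ^ c_i` in the canonical ring of
`∑ α_i D_i`, where `D_i = V(f_i)` has degree `a_i`. -/
def exponents (α : ι → ℚ) (a : ι → ℕ) : AddSubmonoid (ℕ × (ι → ℤ)) where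
  carrier := {x | x ∈ slackCone α ∧ ∑ i, x.2 i * (a i : ℤ) = 0}
  zero_mem' := ⟨zero_mem _, by simp⟩
  add_mem' := by
    rintro x y ⟨hx, hx'⟩ ⟨hy, hy'⟩
    exact ⟨add_mem hx hy, by simp [add_mul, Finset.sum_add_distrib, hx', hy']⟩

/-- This identity converts between degrees and slacks: on the cone the last term vanishes, so bounds
on slacks are bounds on the degree. -/
theorem sum_slack_mul (α : ι → ℚ) (a : ι → ℕ) (x : ℕ × (ι → ℤ)) :
    ∑ i, slack α x i * a i = x.1 * (∑ i, α i * a i) + ((∑ i, x.2 i * (a i : ℤ) : ℤ) : ℚ) := by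
  simp only [slack, add_mul, Finset.sum_add_distrib, Finset.mul_sum, mul_assoc]
  push_cast
  ring

/-- In degree `d` each slack is at most `∑ slack_j a_j = d deg D`, because `a_i ≥ 1`; this confines
`c` to a box. -/
theorem exponents_finite {α : ι → ℚ} {a : ι → ℕ} (ha : ∀ i, 0 < a i) (N : ℕ) :
    {x | x ∈ exponents α a ∧ x.1 ≤ N}.Finite := by
  classical
  have h : ∀ d : ℕ, (Set.Icc ((d, fun i => ⌊-(d * α i)⌋) : ℕ × (ι → ℤ))
      (d, fun i => ⌈d * (∑ j, α j * a j) - d * α i⌉)).Finite := fun d => Set.finite_Icc _ _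
  refine ((Set.finite_Iic N).biUnion fun d _ => h d).subset ?_
  rintro ⟨d, c⟩ ⟨⟨hx, hx'⟩, hd⟩
  simp only [Set.mem_iUnion]
  refine ⟨d, hd, ⟨le_rfl, fun i => ?_⟩, ⟨le_rfl, fun i => ?_⟩⟩
  · have h1 : (0 : ℚ) ≤ c i + d * α i := hx i
    have h2 : (⌊-(d * α i)⌋ : ℚ) ≤ c i := (Int.floor_le _).trans (by linarith)
    exact_mod_cast h2
  · have h1 := sum_slack_mul α a (d, c)
    rw [hx', Int.cast_zero, add_zero] at h1
    have h2 : slack α (d, c) i * a i ≤ ∑ j, slack α (d, c) j * a j :=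
      Finset.single_le_sum (f := fun j => slack α (d, c) j * a j)
        (fun j _ => mul_nonneg (hx j) (Nat.cast_nonneg _)) (Finset.mem_univ i)
    have h3 : slack α (d, c) i ≤ slack α (d, c) i * a i :=
      le_mul_of_one_le_right (hx i) (by exact_mod_cast ha i)
    have h4 : (c i : ℚ) ≤ d * (∑ j, α j * a j) - d * α i := by
      have : (c i : ℚ) + d * α i ≤ d * (∑ j, α j * a j) := (h3.trans h2).trans h1.le
      linarith
    exact_mod_cast h4.trans (Int.le_ceil _)

/-! ### Rays of the cone and division with remainder -/

/-- Lattice points on the extremal rays of the cone of a divisor: the `i`-th one has degree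
`ℓ_i a_i` and lies on all facets but the `i`-th. -/
structure RaySystem (α : ι → ℚ) (a ℓ : ι → ℕ) where
  ray : ι → ℕ × (ι → ℤ)
  fst_ray : ∀ i, (ray i).1 = ℓ i * a i
  slack_ray_self : ∀ i, slack α (ray i) i = ℓ i * ∑ j, α j * a j
  slack_ray_of_ne : ∀ i j, j ≠ i → slack α (ray i) j = 0
  degree_pos : 0 < ∑ j, α j * (a j : ℚ)
  a_pos : ∀ i, 0 < a i
  ℓ_pos : ∀ i, 0 < ℓ i

theorem exists_raySystem [DecidableEq ι] {α : ι → ℚ} {a : ι → ℕ} (ha : ∀ i, 0 < a i)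
    (hdeg : 0 < ∑ j, α j * (a j : ℚ)) :
    Nonempty (RaySystem α a fun i => (Finset.univ.erase i).lcm fun j => (α j).den) := by
  set ℓ : ι → ℕ := fun i => (Finset.univ.erase i).lcm fun j => (α j).den with hℓ
  have hint : ∀ i j, j ≠ i → ∃ z : ℤ, (z : ℚ) = ℓ i * α j := by
    intro i j hj
    obtain ⟨k, hk⟩ : (α j).den ∣ ℓ i :=
      Finset.dvd_lcm (f := fun j => (α j).den) (Finset.mem_erase.2 ⟨hj, Finset.mem_univ j⟩)
    refine ⟨k * (α j).num, ?_⟩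
    rw [hk]
    push_cast
    rw [← Rat.mul_den_eq_num]
    ring
  choose! z hz using hint
  -- In degree `ℓ_i a_i`, vanishing of the other slacks forces `c_j = -ℓ_i α_j a_i`, integral by the
  -- choice of `ℓ_i`. Then `∑ c_j a_j = 0` forces `c_i = ∑_{k ≠ i} ℓ_i α_k a_k`; the factor `a_i` in
  -- the degree makes this an integer.
  refine ⟨⟨fun i => (ℓ i * a i, fun j => if j = i then
    ∑ k ∈ Finset.univ.erase i, z i k * (a k : ℤ) else -(z i j * a i)), fun i => rfl, fun i => ?_,
    fun i j hj => ?_, hdeg, ha, fun i => ?_⟩⟩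
  · simp only [slack, if_true]
    rw [← Finset.add_sum_erase _ _ (Finset.mem_univ i), mul_add, Finset.mul_sum]
    push_cast
    rw [Finset.sum_congr rfl fun k hk => by
      rw [hz i k (Finset.ne_of_mem_erase hk), mul_assoc]]
    ring
  · simp only [slack, if_neg hj]
    push_cast
    rw [hz i j hj]
    ring
  · rw [Nat.pos_iff_ne_zero]
    simp [hℓ, Finset.lcm_eq_zero_iff]

namespace RaySystem

variable {α : ι → ℚ} {a ℓ : ι → ℕ} (V : RaySystem α a ℓ)

theorem slack_ray_nonneg (i j : ι) : 0 ≤ slack α (V.ray i) j := by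
  by_cases h : j = i
  · rw [h, V.slack_ray_self]
    exact mul_nonneg (Nat.cast_nonneg _) V.degree_pos.le
  · rw [V.slack_ray_of_ne i j h]

theorem ray_mem (i : ι) : V.ray i ∈ exponents α a := by
  refine ⟨V.slack_ray_nonneg i, ?_⟩
  have h := sum_slack_mul α a (V.ray i)
  rw [Finset.sum_eq_single i (fun j _ hj => by rw [V.slack_ray_of_ne i j hj, zero_mul]) (by simp),
    V.slack_ray_self, V.fst_ray] at h
  have : ((∑ j, (V.ray i).2 j * (a j : ℤ) : ℤ) : ℚ) = 0 := by
    push_cast at h ⊢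
    linarith
  exact_mod_cast this

theorem fst_ray_le (i : ι) : (V.ray i).1 ≤ ∑ j, ℓ j * a j := by
  rw [V.fst_ray]
  exact Finset.single_le_sum (f := fun j => ℓ j * a j) (fun j _ => Nat.zero_le _)
    (Finset.mem_univ i)

include V in
theorem facet_pos (i : ι) : 0 < ℓ i * ∑ j, α j * (a j : ℚ) :=
  mul_pos (Nat.cast_pos.2 (V.ℓ_pos i)) V.degree_pos

include V in
/-- Lattice points of large degree remain in the cone when a suitable ray is subtracted. -/
theorem exists_eq_add_ray {x : ℕ × (ι → ℤ)} (hx : x ∈ slackCone α) {b : ℕ} [Nonempty ι]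
    (hb : ∑ i, x.2 i * (a i : ℤ) = -b)
    (hle : (b : ℚ) / (∑ j, α j * a j) + ((∑ j, ℓ j * a j : ℕ) : ℚ) ≤ x.1) :
    ∃ j, ∃ y ∈ slackCone α, x = y + V.ray j ∧ y.1 < x.1 := by
  have hΔ := V.degree_pos
  -- Otherwise summing the slacks with weights `a_i` gives `x.1 deg D - b < N deg D`, against `hle`.
  obtain ⟨j, hj⟩ : ∃ j, ℓ j * ∑ j, α j * (a j : ℚ) ≤ slack α x j := by
    by_contra! hlt
    have h1 := sum_slack_mul α a x
    rw [hb] at h1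
    have h2 : ∑ i, slack α x i * a i < ∑ i, (ℓ i * ∑ j, α j * (a j : ℚ)) * a i :=
      Finset.sum_lt_sum_of_nonempty Finset.univ_nonempty fun i _ =>
        mul_lt_mul_of_pos_right (hlt i) (Nat.cast_pos.2 (V.a_pos i))
    have h3 : ∑ i, (ℓ i * ∑ j, α j * (a j : ℚ)) * a i =
        ((∑ j, ℓ j * a j : ℕ) : ℚ) * ∑ j, α j * (a j : ℚ) := by
      push_cast
      rw [Finset.sum_mul]
      exact Finset.sum_congr rfl fun i _ => by ring
    rw [← le_sub_iff_add_le, div_le_iff₀ hΔ, sub_mul] at hle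
    push_cast at h1 h3 hle
    linarith
  -- Needed so that the subtraction of degrees in `ℕ` is not truncated.
  have hjx : (V.ray j).1 ≤ x.1 := by
    have h1 : ((∑ j, ℓ j * a j : ℕ) : ℚ) ≤ x.1 :=
      (le_add_of_nonneg_left (div_nonneg (Nat.cast_nonneg _) hΔ.le)).trans hle
    exact (V.fst_ray_le j).trans (by exact_mod_cast h1)
  have heq : x = (x.1 - (V.ray j).1, x.2 - (V.ray j).2) + V.ray j :=
    Prod.ext (Nat.sub_add_cancel hjx).symm (sub_add_cancel _ _).symm
  refine ⟨j, _, fun i => ?_, heq, ?_⟩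
  · have h := slack_add α (x.1 - (V.ray j).1, x.2 - (V.ray j).2) (V.ray j) i
    rw [← heq] at h
    by_cases hij : i = j
    · rw [hij] at h ⊢
      rw [V.slack_ray_self] at h
      linarith
    · rw [V.slack_ray_of_ne j i hij] at h
      have := hx i
      linarith
  · have : 0 < (V.ray j).1 := V.fst_ray j ▸ Nat.mul_pos (V.ℓ_pos j) (V.a_pos j)
    simp only
    omega

/-- The integral part of the `i`-th coordinate with respect to the rays. -/
noncomputable def quot (_ : RaySystem α a ℓ) (x : ℕ × (ι → ℤ)) (i : ι) : ℕ :=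
  ⌊slack α x i / (ℓ i * ∑ j, α j * (a j : ℚ))⌋₊

theorem slack_sum_smul_ray (k : ι → ℕ) (i : ι) :
    slack α (∑ j, k j • V.ray j) i = k i * (ℓ i * ∑ j, α j * (a j : ℚ)) := by
  rw [slack_sum, Finset.sum_eq_single i]
  · rw [slack_nsmul, V.slack_ray_self]
  · intro j _ hj
    rw [slack_nsmul, V.slack_ray_of_ne j i hj.symm, mul_zero]
  · simp

theorem quot_add_smul {x : ℕ × (ι → ℤ)} (hx : x ∈ slackCone α) (k : ι → ℕ) (i : ι) :
    V.quot (x + ∑ j, k j • V.ray j) i = V.quot x i + k i := by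
  rw [quot, slack_add, V.slack_sum_smul_ray, add_div, mul_div_cancel_right₀ _ (V.facet_pos i).ne',
    Nat.floor_add_natCast (div_nonneg (hx i) (V.facet_pos i).le)]
  rfl

/-- After subtraction each slack lies in `[0, ℓ_i deg D)`, and the weighted sum of these bounds,
divided by `deg D`, is `∑ ℓ_j a_j`. -/
theorem exists_rem {x : ℕ × (ι → ℤ)} (hx : x ∈ exponents α a) :
    ∃ r ∈ exponents α a, r + ∑ j, V.quot x j • V.ray j = x ∧ r.1 ≤ ∑ j, ℓ j * a j := by
  have hΔ := V.degree_pos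
  set s := ∑ j, V.quot x j • V.ray j with hs
  have hsM : s ∈ exponents α a := sum_mem fun j _ => nsmul_mem (V.ray_mem j) _
  have hle : ∀ i, slack α s i ≤ slack α x i := by
    intro i
    rw [hs, V.slack_sum_smul_ray, ← le_div_iff₀ (V.facet_pos i)]
    exact Nat.floor_le (div_nonneg (hx.1 i) (V.facet_pos i).le)
  have hlt : ∀ i, slack α x i < slack α s i + ℓ i * ∑ j, α j * (a j : ℚ) := by
    intro i
    have := Nat.lt_floor_add_one (slack α x i / (ℓ i * ∑ j, α j * (a j : ℚ)))
    rw [div_lt_iff₀ (V.facet_pos i), add_mul, one_mul] at this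
    rwa [hs, V.slack_sum_smul_ray]
  have h1 := sum_slack_mul α a x
  have h2 := sum_slack_mul α a s
  rw [hx.2, Int.cast_zero, add_zero] at h1
  rw [hsM.2, Int.cast_zero, add_zero] at h2
  have hsx : s.1 ≤ x.1 := by
    have h3 : ∑ i, slack α s i * a i ≤ ∑ i, slack α x i * a i :=
      Finset.sum_le_sum fun i _ => mul_le_mul_of_nonneg_right (hle i) (Nat.cast_nonneg _)
    rw [h1, h2, mul_le_mul_iff_left₀ hΔ] at h3
    exact_mod_cast h3
  have heq : (x.1 - s.1, x.2 - s.2) + s = x :=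
    Prod.ext (Nat.sub_add_cancel hsx) (sub_add_cancel _ _)
  refine ⟨(x.1 - s.1, x.2 - s.2), ⟨fun i => ?_, ?_⟩, heq, ?_⟩
  · have h := slack_add α (x.1 - s.1, x.2 - s.2) s i
    rw [heq] at h
    linarith [hle i]
  · simp [sub_mul, Finset.sum_sub_distrib, hx.2, hsM.2]
  · have h3 : ∑ i, slack α x i * a i ≤
        ∑ i, (slack α s i + ℓ i * ∑ j, α j * (a j : ℚ)) * a i :=
      Finset.sum_le_sum fun i _ => mul_le_mul_of_nonneg_right (hlt i).le (Nat.cast_nonneg _)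
    have h4 : ∑ i, (slack α s i + ℓ i * ∑ j, α j * (a j : ℚ)) * a i =
        (s.1 + (∑ j, ℓ j * a j : ℕ) : ℚ) * ∑ j, α j * (a j : ℚ) := by
      rw [add_mul, ← h2]
      simp only [add_mul, Finset.sum_add_distrib]
      push_cast
      rw [Finset.sum_mul]
      congr 1
      exact Finset.sum_congr rfl fun i _ => by ring
    rw [h1, h4, mul_le_mul_iff_left₀ hΔ] at h3
    have h5 : x.1 ≤ s.1 + ∑ j, ℓ j * a j := by exact_mod_cast h3
    simp only
    omega

open Classical in
/-- The fractional part of a lattice point with respect to the rays. -/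
noncomputable def rem (x : ℕ × (ι → ℤ)) : ℕ × (ι → ℤ) :=
  if hx : x ∈ exponents α a then (V.exists_rem hx).choose else 0

theorem rem_mem (x : ℕ × (ι → ℤ)) : V.rem x ∈ exponents α a := by
  rw [rem]
  split_ifs with hx
  · exact (V.exists_rem hx).choose_spec.1
  · exact zero_mem _

theorem rem_add {x : ℕ × (ι → ℤ)} (hx : x ∈ exponents α a) :
    V.rem x + ∑ j, V.quot x j • V.ray j = x := by
  rw [rem, dif_pos hx]
  exact (V.exists_rem hx).choose_spec.2.1

theorem fst_rem_le (x : ℕ × (ι → ℤ)) : (V.rem x).1 ≤ ∑ j, ℓ j * a j := by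
  rw [rem]
  split_ifs with hx
  · exact (V.exists_rem hx).choose_spec.2.2
  · exact Nat.zero_le _

/-- The carry in adding two points depends only on their remainders. With `rem_add_rem`, this
reduces multiplicativity of lifts to sums of two remainders. -/
theorem quot_add {x y : ℕ × (ι → ℤ)} (hx : x ∈ exponents α a) (hy : y ∈ exponents α a) (i : ι) :
    V.quot (x + y) i = V.quot (V.rem x + V.rem y) i + (V.quot x i + V.quot y i) := by
  have h : x + y = (V.rem x + V.rem y) + ∑ j, (V.quot x j + V.quot y j) • V.ray j := by
    conv_lhs => rw [← V.rem_add hx, ← V.rem_add hy]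
    simp only [add_smul, Finset.sum_add_distrib]
    abel
  conv_lhs => rw [h]
  exact V.quot_add_smul (add_mem (V.rem_mem x) (V.rem_mem y)).1 _ i

theorem rem_add_rem {x y : ℕ × (ι → ℤ)} (hx : x ∈ exponents α a) (hy : y ∈ exponents α a) :
    V.rem (x + y) = V.rem (V.rem x + V.rem y) := by
  have h1 := V.rem_add (add_mem hx hy)
  have h2 := V.rem_add (add_mem (V.rem_mem x) (V.rem_mem y))
  conv_rhs at h1 => rw [← V.rem_add hx, ← V.rem_add hy, add_add_add_comm, ← h2]
  simp only [V.quot_add hx hy, add_smul, Finset.sum_add_distrib] at h1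
  rw [add_assoc] at h1
  exact add_right_cancel h1

end RaySystem

end ProjDiv

/-! ### Linear combinations over translated exponents -/

noncomputable section

namespace ProjDiv

section ShiftSum

variable {ι K : Type*} [Field K] {B : Type*} [AddCommGroup B] [Module K B]

/-- The exponent of `u ^ d ∏ f_i ^ (c_i + e_i)`. -/
def shift (x : ℕ × (ι → ℤ)) (e : ι →₀ ℕ) : ℕ × (ι → ℤ) := x + (0, fun i => (e i : ℤ))

theorem shift_add (x y : ℕ × (ι → ℤ)) (e : ι →₀ ℕ) : shift (x + y) e = shift x e + y := by
  simp only [shift, add_right_comm]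

theorem shift_shift (x : ℕ × (ι → ℤ)) (e e' : ι →₀ ℕ) :
    shift (shift x e) e' = shift x (e + e') := by
  simp only [shift, add_assoc]
  congr 1

theorem shift_mem_slackCone {α : ι → ℚ} {x : ℕ × (ι → ℤ)} (hx : x ∈ slackCone α) (e : ι →₀ ℕ) :
    shift x e ∈ slackCone α :=
  add_mem hx fun i => by simp [slack]

theorem fst_shift (x : ℕ × (ι → ℤ)) (e : ι →₀ ℕ) : (shift x e).1 = x.1 := by simp [shift]

/-- The linear map `y ^ e ↦ G (x + e)`. -/
def shiftSum (G : ℕ × (ι → ℤ) → B) (x : ℕ × (ι → ℤ)) : MvPolynomial ι K →ₗ[K] B :=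
  (basisMonomials ι K).constr K fun e => G (shift x e)

theorem shiftSum_monomial (G : ℕ × (ι → ℤ) → B) (x : ℕ × (ι → ℤ)) (e : ι →₀ ℕ) (c : K) :
    shiftSum G x (monomial e c) = c • G (shift x e) := by
  have h : monomial e c = c • basisMonomials ι K e := by simp [smul_monomial]
  rw [h, map_smul, shiftSum, Module.Basis.constr_basis]

theorem shiftSum_apply (G : ℕ × (ι → ℤ) → B) (x : ℕ × (ι → ℤ)) (q : MvPolynomial ι K) :
    shiftSum G x q = ∑ e ∈ q.support, coeff e q • G (shift x e) := by
  conv_lhs => rw [q.as_sum, map_sum]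
  exact Finset.sum_congr rfl fun e _ => shiftSum_monomial G x e _

theorem shiftSum_monomial_mul (G : ℕ × (ι → ℤ) → B) (x : ℕ × (ι → ℤ)) (e : ι →₀ ℕ) (c : K)
    (q : MvPolynomial ι K) :
    shiftSum G x (monomial e c * q) = c • shiftSum G (shift x e) q := by
  induction q using MvPolynomial.induction_on' with
  | monomial e' c' =>
    rw [monomial_mul, shiftSum_monomial, shiftSum_monomial, shift_shift, mul_smul]
  | add p q hp hq => rw [mul_add, map_add, map_add, hp, hq, smul_add]

theorem map_shiftSum {B' : Type*} [AddCommGroup B'] [Module K B'] (φ : B →ₗ[K] B')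
    (G : ℕ × (ι → ℤ) → B) (x : ℕ × (ι → ℤ)) (q : MvPolynomial ι K) :
    φ (shiftSum G x q) = shiftSum (fun y => φ (G y)) x q := by
  simp only [shiftSum_apply, map_sum, map_smul]

/-- Used to pull a ray monomial out of a whole relation at once. -/
theorem shiftSum_mul {A : Type*} [CommRing A] [Algebra K A] (G : ℕ × (ι → ℤ) → A)
    {x y : ℕ × (ι → ℤ)} {c : A} (q : MvPolynomial ι K)
    (h : ∀ e ∈ q.support, G (shift x e) = G (shift y e) * c) :
    shiftSum G x q = shiftSum G y q * c := by
  rw [shiftSum_apply, shiftSum_apply, Finset.sum_mul]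
  exact Finset.sum_congr rfl fun e he => by rw [h e he, smul_mul_assoc]

/-- A map killing all translates of the generators of an ideal kills the ideal. -/
theorem shiftSum_eq_zero_of_mem_span (G : ℕ × (ι → ℤ) → B) {s : Set (MvPolynomial ι K)}
    {C : Set (ℕ × (ι → ℤ))} (hC : ∀ x ∈ C, ∀ e, shift x e ∈ C)
    (hs : ∀ x ∈ C, ∀ p ∈ s, shiftSum G x p = 0) {q : MvPolynomial ι K} (hq : q ∈ Ideal.span s)
    {x : ℕ × (ι → ℤ)} (hx : x ∈ C) : shiftSum G x q = 0 := by
  induction hq using Submodule.span_induction generalizing x with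
  | mem p hp => exact hs x hx p hp
  | zero => exact map_zero _
  | add p q _ _ hp hq => rw [map_add, hp hx, hq hx, add_zero]
  | smul r p _ hp =>
    rw [smul_eq_mul]
    -- Multiplication by a monomial only translates the base point, and `C` is stable under
    -- translation.
    induction r using MvPolynomial.induction_on' with
    | monomial e c => rw [shiftSum_monomial_mul, hp (hC x hx e), smul_zero]
    | add r r' hr hr' => rw [add_mul, map_add, hr, hr', add_zero]

end ShiftSum

/-- Weighted homogeneous polynomials in homogeneous elements are homogeneous. -/
theorem aeval_mem_of_isWeightedHomogeneous {K R : Type*} [Field K] [CommRing R] [Algebra K R]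
    {𝒜 : ℕ → Submodule K R} [SetLike.GradedMonoid 𝒜] {r : ℕ} {deg : Fin r → ℕ} {w : Fin r → R}
    (hw : ∀ j, w j ∈ 𝒜 (deg j)) {p : MvPolynomial (Fin r) K} {d : ℕ}
    (hp : IsWeightedHomogeneous deg p d) : aeval w p ∈ 𝒜 d := by
  rw [aeval_def, eval₂_eq]
  refine sum_mem fun e he => ?_
  rw [← Algebra.smul_def]
  refine Submodule.smul_mem _ _ ?_
  rw [← hp (mem_support_iff.1 he), Finsupp.weight_apply,
    Finsupp.sum_of_support_subset _ (Finset.subset_univ _) _ (by simp)]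
  rw [Finset.prod_subset (Finset.subset_univ _) (by simp +contextual)]
  exact SetLike.prod_mem_graded _ _ _ fun i _ => SetLike.pow_mem_graded _ (hw i)

/-! ### Algebras graded by monomials: generators -/

/-- A grading of an algebra by monomials whose exponents are the lattice points of the cone of a
divisor; the linear relations in each degree are those among the monomials in the `f_i`. -/
structure MonomialGrading {ι : Type*} [Fintype ι] (α : ι → ℚ) (a : ι → ℕ) {K R S : Type*}
    [Field K] [CommRing R] [Algebra K R] [CommRing S] [Algebra K S] (𝒜 : ℕ → Submodule K R)
    (f : ι → S) where
  mono : ℕ × (ι → ℤ) → R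
  mono_zero : mono 0 = 1
  mono_add : ∀ {x y}, x ∈ exponents α a → y ∈ exponents α a → mono (x + y) = mono x * mono y
  mono_of_notMem : ∀ {x}, x ∉ exponents α a → mono x = 0
  mono_mem : ∀ {x}, x ∈ exponents α a → mono x ∈ 𝒜 x.1
  le_span : ∀ d, 𝒜 d ≤ Submodule.span K (mono '' {x | x ∈ exponents α a ∧ x.1 = d})
  graded : SetLike.GradedMonoid 𝒜
  independent : ∀ (s : Finset ℕ) (y : ℕ → R), (∀ d, y d ∈ 𝒜 d) → ∑ d ∈ s, y d = 0 →
    ∀ d ∈ s, y d = 0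
  iSup_eq_top : ⨆ d, 𝒜 d = ⊤
  shiftSum_eq_zero_iff : ∀ (x : ℕ × (ι → ℤ)) (q : MvPolynomial ι K),
    (∀ e ∈ q.support, shift x e ∈ exponents α a) → (shiftSum mono x q = 0 ↔ aeval f q = 0)

namespace MonomialGrading

variable {ι : Type*} [Fintype ι] {α : ι → ℚ} {a : ι → ℕ} {K R S : Type*}
  [Field K] [CommRing R] [Algebra K R] [CommRing S] [Algebra K S] {𝒜 : ℕ → Submodule K R}
  {f : ι → S} (M : MonomialGrading α a 𝒜 f)

theorem mono_nsmul {x : ℕ × (ι → ℤ)} (hx : x ∈ exponents α a) (k : ℕ) :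
    M.mono (k • x) = M.mono x ^ k := by
  induction k with
  | zero => rw [zero_smul, M.mono_zero, pow_zero]
  | succ k ih => rw [succ_nsmul, M.mono_add (nsmul_mem hx k) hx, ih, pow_succ]

theorem mono_sum {κ : Type*} (s : Finset κ) {x : κ → ℕ × (ι → ℤ)}
    (hx : ∀ k ∈ s, x k ∈ exponents α a) : M.mono (∑ k ∈ s, x k) = ∏ k ∈ s, M.mono (x k) := by
  classical
  induction s using Finset.induction_on with
  | empty => simp [M.mono_zero]
  | insert k s hk ih =>
    rw [Finset.sum_insert hk, Finset.prod_insert hk,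
      M.mono_add (hx k (by simp)) (sum_mem fun j hj => hx j (by simp [hj])),
      ih fun j hj => hx j (by simp [hj])]

theorem mono_eq_rem {ℓ : ι → ℕ} (V : RaySystem α a ℓ) {x : ℕ × (ι → ℤ)}
    (hx : x ∈ exponents α a) :
    M.mono x = M.mono (V.rem x) * ∏ i, M.mono (V.ray i) ^ V.quot x i := by
  conv_lhs => rw [← V.rem_add hx]
  rw [M.mono_add (V.rem_mem x) (sum_mem fun i _ => nsmul_mem (V.ray_mem i) _),
    M.mono_sum _ fun i _ => nsmul_mem (V.ray_mem i) _]
  simp only [M.mono_nsmul (V.ray_mem _)]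

include M in
/-- The monomials of degree at most `∑ ℓ_i a_i` generate the algebra. -/
theorem exists_isHomogeneousGeneratingSystem {ℓ : ι → ℕ} (V : RaySystem α a ℓ) :
    ∃ (r : ℕ) (deg : Fin r → ℕ) (w : Fin r → R), (∀ j, deg j ≤ ∑ i, ℓ i * a i) ∧
      IsHomogeneousGeneratingSystem 𝒜 deg w := by
  have hfin := exponents_finite (α := α) V.a_pos (∑ i, ℓ i * a i)
  obtain ⟨r, v, -, hv⟩ := hfin.fin_param
  have hvmem : ∀ j, v j ∈ exponents α a ∧ (v j).1 ≤ ∑ i, ℓ i * a i := fun j => by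
    have : v j ∈ {x | x ∈ exponents α a ∧ x.1 ≤ ∑ i, ℓ i * a i} := hv ▸ Set.mem_range_self j
    exact this
  have hlow : ∀ x ∈ exponents α a, x.1 ≤ ∑ i, ℓ i * a i →
      M.mono x ∈ Algebra.adjoin K (Set.range fun j => M.mono (v j)) := by
    intro x hx hx'
    obtain ⟨j, rfl⟩ : x ∈ Set.range v := hv ▸ ⟨hx, hx'⟩
    exact Algebra.subset_adjoin ⟨j, rfl⟩
  refine ⟨r, fun j => (v j).1, fun j => M.mono (v j), fun j => (hvmem j).2,
    fun j => M.mono_mem (hvmem j).1, ?_⟩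
  rw [eq_top_iff]
  intro y _
  rw [← Subalgebra.mem_toSubmodule]
  have hy : y ∈ ⨆ d, 𝒜 d := M.iSup_eq_top ▸ Submodule.mem_top
  refine (?_ : (⨆ d, 𝒜 d) ≤ _) hy
  refine iSup_le fun d => (M.le_span d).trans (Submodule.span_le.2 ?_)
  rintro _ ⟨x, ⟨hx, -⟩, rfl⟩
  rw [SetLike.mem_coe, Subalgebra.mem_toSubmodule, M.mono_eq_rem V hx]
  exact mul_mem (hlow _ (V.rem_mem x) (V.fst_rem_le x))
    (prod_mem fun i _ => pow_mem (hlow _ (V.ray_mem i) (V.fst_ray_le i)) _)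

/-! ### Algebras graded by monomials: relations -/

section Relations

variable {r : ℕ} {deg : Fin r → ℕ} {w : Fin r → R}

include M in
theorem aeval_weightedHomogeneousComponent (hw : ∀ j, w j ∈ 𝒜 (deg j))
    {p : MvPolynomial (Fin r) K} {d : ℕ} (hp : aeval w p ∈ 𝒜 d) :
    aeval w (weightedHomogeneousComponent deg d p) = aeval w p := by
  classical
  -- The index `d` is inserted because `p` may have no term of weight `d`, while the conclusion is
  -- read off at `d`.
  set s : Finset ℕ := insert d (p.support.image (Finsupp.weight deg)) with hs
  have hsum : ∑ k ∈ s, weightedHomogeneousComponent deg k p = p := by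
    ext e
    rw [coeff_sum]
    simp only [coeff_weightedHomogeneousComponent, Finset.sum_ite_eq]
    split_ifs with h
    · rfl
    · by_contra h0
      exact h (Finset.mem_insert_of_mem
        (Finset.mem_image_of_mem _ (mem_support_iff.2 (Ne.symm h0))))
  have h := M.independent s (fun k => aeval w (weightedHomogeneousComponent deg k p) -
    if k = d then aeval w p else 0) (fun k => ?_) ?_ d (Finset.mem_insert_self _ _)
  · simpa [sub_eq_zero] using h
  · have := M.graded
    refine sub_mem (aeval_mem_of_isWeightedHomogeneous hw
      (weightedHomogeneousComponent_isWeightedHomogeneous k p)) ?_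
    split_ifs with hk
    · exact hk ▸ hp
    · exact zero_mem _
  · rw [Finset.sum_sub_distrib, ← map_sum, hsum, Finset.sum_ite_eq',
      if_pos (Finset.mem_insert_self _ _), sub_self]

include M in
theorem exists_lift (hw : IsHomogeneousGeneratingSystem 𝒜 deg w) {d : ℕ} {y : R} (hy : y ∈ 𝒜 d) :
    ∃ p : MvPolynomial (Fin r) K, IsWeightedHomogeneous deg p d ∧ aeval w p = y := by
  have hsurj : y ∈ (aeval w : MvPolynomial (Fin r) K →ₐ[K] R).range := by
    rw [← Algebra.adjoin_range_eq_range_aeval, hw.2]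
    trivial
  obtain ⟨p, rfl⟩ := hsurj
  exact ⟨_, weightedHomogeneousComponent_isWeightedHomogeneous d p,
    M.aeval_weightedHomogeneousComponent hw.1 hy⟩

open Classical in
/-- A homogeneous lift of a monomial to the polynomial ring on the generators. -/
def lift₀ (hw : IsHomogeneousGeneratingSystem 𝒜 deg w) (x : ℕ × (ι → ℤ)) :
    MvPolynomial (Fin r) K :=
  if hx : x ∈ exponents α a then (M.exists_lift hw (M.mono_mem hx)).choose else 0

theorem isWeightedHomogeneous_lift₀ (hw : IsHomogeneousGeneratingSystem 𝒜 deg w)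
    (x : ℕ × (ι → ℤ)) : IsWeightedHomogeneous deg (M.lift₀ hw x) x.1 := by
  rw [lift₀]
  split_ifs with hx
  · exact (M.exists_lift hw (M.mono_mem hx)).choose_spec.1
  · exact isWeightedHomogeneous_zero _ _ _

theorem aeval_lift₀ (hw : IsHomogeneousGeneratingSystem 𝒜 deg w) {x : ℕ × (ι → ℤ)}
    (hx : x ∈ exponents α a) : aeval w (M.lift₀ hw x) = M.mono x := by
  rw [lift₀, dif_pos hx]
  exact (M.exists_lift hw (M.mono_mem hx)).choose_spec.2

variable {ℓ : ι → ℕ} (V : RaySystem α a ℓ)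

open Classical in
/-- A homogeneous lift of a monomial to the polynomial ring on the generators, multiplicative up to
relations of low degree. -/
def lift (hw : IsHomogeneousGeneratingSystem 𝒜 deg w) (x : ℕ × (ι → ℤ)) :
    MvPolynomial (Fin r) K :=
  if x ∈ exponents α a then
    M.lift₀ hw (V.rem x) * ∏ i, M.lift₀ hw (V.ray i) ^ V.quot x i else 0

theorem lift_of_notMem (hw : IsHomogeneousGeneratingSystem 𝒜 deg w) {x : ℕ × (ι → ℤ)}
    (hx : x ∉ exponents α a) : M.lift V hw x = 0 := if_neg hx

theorem lift_of_mem (hw : IsHomogeneousGeneratingSystem 𝒜 deg w) {x : ℕ × (ι → ℤ)}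
    (hx : x ∈ exponents α a) : M.lift V hw x =
      M.lift₀ hw (V.rem x) * ∏ i, M.lift₀ hw (V.ray i) ^ V.quot x i := if_pos hx

theorem isWeightedHomogeneous_lift (hw : IsHomogeneousGeneratingSystem 𝒜 deg w)
    (x : ℕ × (ι → ℤ)) : IsWeightedHomogeneous deg (M.lift V hw x) x.1 := by
  by_cases hx : x ∈ exponents α a
  · rw [M.lift_of_mem V hw hx]
    have h := (M.isWeightedHomogeneous_lift₀ hw (V.rem x)).mul
      (IsWeightedHomogeneous.prod Finset.univ _ (fun i => V.quot x i • (V.ray i).1) fun i _ =>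
        (M.isWeightedHomogeneous_lift₀ hw (V.ray i)).pow (V.quot x i))
    have hdeg := congrArg Prod.fst (V.rem_add hx)
    rw [Prod.fst_add, Prod.fst_sum] at hdeg
    rw [← hdeg]
    exact h
  · rw [M.lift_of_notMem V hw hx]
    exact isWeightedHomogeneous_zero _ _ _

theorem aeval_lift (hw : IsHomogeneousGeneratingSystem 𝒜 deg w) (x : ℕ × (ι → ℤ)) :
    aeval w (M.lift V hw x) = M.mono x := by
  by_cases hx : x ∈ exponents α a
  · rw [M.lift_of_mem V hw hx, map_mul, map_prod, M.mono_eq_rem V hx,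
      M.aeval_lift₀ hw (V.rem_mem x)]
    simp only [map_pow, M.aeval_lift₀ hw (V.ray_mem _)]
  · rw [M.lift_of_notMem V hw hx, map_zero, M.mono_of_notMem hx]

/-- The ideal generated by the homogeneous relations of degree at most `B`. -/
def _root_.ProjDiv.lowRelations (deg : Fin r → ℕ) (w : Fin r → R) (B : ℚ) :
    Ideal (MvPolynomial (Fin r) K) :=
  Ideal.span {p | aeval w p = 0 ∧ ∃ e : ℕ, (e : ℚ) ≤ B ∧ IsWeightedHomogeneous deg p e}

variable {B : ℚ}

theorem _root_.ProjDiv.mk_eq_mk_of_low {p q : MvPolynomial (Fin r) K} {e : ℕ}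
    (he : (e : ℚ) ≤ B) (hp : IsWeightedHomogeneous deg p e) (hq : IsWeightedHomogeneous deg q e)
    (h : aeval w p = aeval w q) :
    Ideal.Quotient.mkₐ K (lowRelations deg w B) p =
      Ideal.Quotient.mkₐ K (lowRelations deg w B) q :=
  Ideal.Quotient.eq.2 (Ideal.subset_span ⟨by rw [map_sub, h, sub_self], e, he, hp.sub hq⟩)

/-- The class of the lift of a monomial modulo relations of low degree. -/
def cls (hw : IsHomogeneousGeneratingSystem 𝒜 deg w) (B : ℚ) (x : ℕ × (ι → ℤ)) :
    MvPolynomial (Fin r) K ⧸ lowRelations deg w B :=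
  Ideal.Quotient.mkₐ K (lowRelations deg w B) (M.lift V hw x)

theorem cls_of_notMem (hw : IsHomogeneousGeneratingSystem 𝒜 deg w) {x : ℕ × (ι → ℤ)}
    (hx : x ∉ exponents α a) : M.cls V hw B x = 0 := by
  rw [cls, M.lift_of_notMem V hw hx, map_zero]

theorem cls_zero (hw : IsHomogeneousGeneratingSystem 𝒜 deg w) (hB : 0 ≤ B) :
    M.cls V hw B 0 = 1 := by
  rw [cls, ← map_one (Ideal.Quotient.mkₐ K (lowRelations deg w B))]
  refine mk_eq_mk_of_low (e := 0) (by simpa using hB) (M.isWeightedHomogeneous_lift V hw 0)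
    (isWeightedHomogeneous_one _ _) ?_
  rw [M.aeval_lift, M.mono_zero, map_one]

/-- The ray factors of the lifts multiply exactly, up to the carry of the two remainders. The only
relation used compares the lift of the sum of the remainders with the product of their lifts, in
degree at most `2N`. -/
theorem cls_add (hw : IsHomogeneousGeneratingSystem 𝒜 deg w)
    (hB : 2 * ((∑ i, ℓ i * a i : ℕ) : ℚ) ≤ B) {x y : ℕ × (ι → ℤ)}
    (hx : x ∈ exponents α a) (hy : y ∈ exponents α a) :
    M.cls V hw B (x + y) = M.cls V hw B x * M.cls V hw B y := by
  set z := V.rem x + V.rem y with hz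
  have hzM : z ∈ exponents α a := add_mem (V.rem_mem x) (V.rem_mem y)
  have hlow : M.cls V hw B z = Ideal.Quotient.mkₐ K (lowRelations deg w B)
      (M.lift₀ hw (V.rem x) * M.lift₀ hw (V.rem y)) := by
    refine mk_eq_mk_of_low (e := z.1) ?_ (M.isWeightedHomogeneous_lift V hw z)
      ((M.isWeightedHomogeneous_lift₀ hw _).mul (M.isWeightedHomogeneous_lift₀ hw _)) ?_
    · refine le_trans ?_ hB
      have h1 := V.fst_rem_le x
      have h2 := V.fst_rem_le y
      have h3 : z.1 ≤ 2 * ∑ i, ℓ i * a i := by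
        rw [hz, Prod.fst_add]
        omega
      exact_mod_cast h3
    · rw [M.aeval_lift, map_mul, M.aeval_lift₀ hw (V.rem_mem x), M.aeval_lift₀ hw (V.rem_mem y),
        hz, M.mono_add (V.rem_mem x) (V.rem_mem y)]
  have h1 : M.lift V hw (x + y) = M.lift V hw z *
      ((∏ i, M.lift₀ hw (V.ray i) ^ V.quot x i) * ∏ i, M.lift₀ hw (V.ray i) ^ V.quot y i) := by
    rw [M.lift_of_mem V hw (add_mem hx hy), M.lift_of_mem V hw hzM, V.rem_add_rem hx hy]
    simp only [V.quot_add hx hy, pow_add, Finset.prod_mul_distrib]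
    ring
  have h2 : M.cls V hw B (x + y) = M.cls V hw B z * Ideal.Quotient.mkₐ K (lowRelations deg w B)
      ((∏ i, M.lift₀ hw (V.ray i) ^ V.quot x i) * ∏ i, M.lift₀ hw (V.ray i) ^ V.quot y i) := by
    rw [cls, h1, map_mul]
    rfl
  rw [h2, hlow, cls, cls, ← map_mul, ← map_mul, M.lift_of_mem V hw hx, M.lift_of_mem V hw hy]
  congr 1
  ring

/-- Relations are translated from base points `x` with `∑ c_i a_i ≠ 0`, so points outside
`exponents` must be allowed. There both sides vanish by the default value zero, as adding a ray does
not change `∑ c_i a_i`. -/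
theorem cls_add_ray (hw : IsHomogeneousGeneratingSystem 𝒜 deg w)
    (hB : 2 * ((∑ i, ℓ i * a i : ℕ) : ℚ) ≤ B) {x : ℕ × (ι → ℤ)} (hx : x ∈ slackCone α) (j : ι) :
    M.cls V hw B (x + V.ray j) = M.cls V hw B x * M.cls V hw B (V.ray j) := by
  by_cases hxM : x ∈ exponents α a
  · exact M.cls_add V hw hB hxM (V.ray_mem j)
  · rw [M.cls_of_notMem V hw hxM, zero_mul]
    refine M.cls_of_notMem V hw fun h => hxM ⟨hx, ?_⟩
    have h1 := h.2
    have h2 := (V.ray_mem j).2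
    simp only [Prod.snd_add, Pi.add_apply, add_mul, Finset.sum_add_distrib, h2, add_zero] at h1
    exact h1

/-- Homogeneous relations among the `f_i` give relations that follow from those of low degree. -/
theorem shiftSum_cls_eq_zero (hw : IsHomogeneousGeneratingSystem 𝒜 deg w)
    (hB : 2 * ((∑ i, ℓ i * a i : ℕ) : ℚ) ≤ B) {b : ℕ}
    (hb : (b : ℚ) / (∑ j, α j * a j) + ((∑ j, ℓ j * a j : ℕ) : ℚ) ≤ B) [Nonempty ι]
    {q : MvPolynomial ι K} (hq : IsWeightedHomogeneous a q b) (hfq : aeval f q = 0)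
    {x : ℕ × (ι → ℤ)} (hx : x ∈ slackCone α) : shiftSum (M.cls V hw B) x q = 0 := by
  have hweight : ∀ e ∈ q.support, ∑ i, (e i : ℤ) * a i = b := by
    intro e he
    have h := hq (mem_support_iff.1 he)
    rw [Finsupp.weight_apply, Finsupp.sum_fintype _ _ (by simp)] at h
    rw [← h]
    push_cast
    simp
  have hsum : ∀ e ∈ q.support, ∑ i, (shift x e).2 i * (a i : ℤ) =
      ∑ i, x.2 i * (a i : ℤ) + b := by
    intro e he
    rw [← hweight e he]
    simp [shift, add_mul, Finset.sum_add_distrib]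
  induction hd : x.1 using Nat.strong_induction_on generalizing x with
  | _ d ih =>
    -- For any other value of `∑ x_i a_i`, every translate violates `∑ c_i a_i = 0` and has class
    -- zero.
    by_cases hxb : ∑ i, x.2 i * (a i : ℤ) = -b
    · have hgood : ∀ e ∈ q.support, shift x e ∈ exponents α a := fun e he =>
        ⟨shift_mem_slackCone hx e, by rw [hsum e he, hxb, neg_add_cancel]⟩
      -- In degree at most `B` the combination of lifts is itself one of the generating relations;
      -- above `B` a ray splits off and induction on the degree applies.
      by_cases hdB : (x.1 : ℚ) ≤ B
      · have h1 : shiftSum (M.cls V hw B) x q =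
            Ideal.Quotient.mkₐ K (lowRelations deg w B) (shiftSum (M.lift V hw) x q) :=
          (map_shiftSum (Ideal.Quotient.mkₐ K (lowRelations deg w B)).toLinearMap _ x q).symm
        rw [h1, ← map_zero (Ideal.Quotient.mkₐ K (lowRelations deg w B))]
        refine mk_eq_mk_of_low hdB ?_ (isWeightedHomogeneous_zero _ _ _) ?_
        · rw [shiftSum_apply]
          refine IsWeightedHomogeneous.sum _ _ _ fun e _ => ?_
          rw [smul_eq_C_mul]
          exact (fst_shift x e ▸ M.isWeightedHomogeneous_lift V hw (shift x e)).C_mul _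
        · rw [map_zero]
          have h2 := map_shiftSum (aeval w : MvPolynomial (Fin r) K →ₐ[K] R).toLinearMap
            (M.lift V hw) x q
          simp only [AlgHom.toLinearMap_apply, M.aeval_lift V hw] at h2
          rw [h2]
          exact (M.shiftSum_eq_zero_iff x q hgood).2 hfq
      · obtain ⟨j, y, hy, hxy, hlt⟩ := V.exists_eq_add_ray hx hxb (hb.trans (not_le.1 hdB).le)
        rw [shiftSum_mul (y := y) (c := M.cls V hw B (V.ray j)) _ _ fun e _ => ?_,
          ih y.1 (hd ▸ hlt) hy ?_ rfl, zero_mul]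
        · intro e he
          rw [← hweight e he]
          simp [shift, add_mul, Finset.sum_add_distrib]
        · rw [hxy, shift_add, M.cls_add_ray V hw hB (shift_mem_slackCone hy e)]
    · rw [shiftSum_apply]
      refine Finset.sum_eq_zero fun e he => ?_
      rw [M.cls_of_notMem V hw fun h => hxb ?_, smul_zero]
      have := h.2
      rw [hsum e he] at this
      linarith

/-- Modulo relations of low degree, every polynomial in the generators that is homogeneous of degree
`d` is a combination of lifts of monomials. -/
theorem exists_mk_eq_shiftSum (hw : IsHomogeneousGeneratingSystem 𝒜 deg w)
    (hdeg : ∀ j, deg j ≤ ∑ i, ℓ i * a i) (hB : 2 * ((∑ i, ℓ i * a i : ℕ) : ℚ) ≤ B)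
    {p : MvPolynomial (Fin r) K} {d : ℕ} (hp : IsWeightedHomogeneous deg p d) :
    ∃ q : MvPolynomial ι K,
      (∀ e ∈ q.support, shift (d, -fun i => ⌊d * α i⌋) e ∈ exponents α a) ∧
      Ideal.Quotient.mkₐ K (lowRelations deg w B) p = Ideal.Quotient.mkₐ K (lowRelations deg w B)
        (shiftSum (M.lift V hw) (d, -fun i => ⌊d * α i⌋) q) := by
  set J : Ideal (MvPolynomial (Fin r) K) := lowRelations deg w B with hJ
  let E : ℕ → Set (ℕ × (ι → ℤ)) := fun d => {x | x ∈ exponents α a ∧ x.1 = d}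
  let 𝒰 : ℕ → Submodule K (MvPolynomial (Fin r) K) := fun d =>
    Submodule.span K (M.lift V hw '' E d)
  let 𝒬 : ℕ → Submodule K (MvPolynomial (Fin r) K ⧸ J) := fun d =>
    (𝒰 d).map (Ideal.Quotient.mkₐ K J).toLinearMap
  have h𝒬 : ∀ d, 𝒬 d = Submodule.span K (M.cls V hw B '' E d) := fun d => by
    change (𝒰 d).map _ = _
    rw [Submodule.map_span, Set.image_image]
    rfl
  have hN0 : (0 : ℚ) ≤ ((∑ i, ℓ i * a i : ℕ) : ℚ) := Nat.cast_nonneg _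
  -- The spans of classes of lifts multiply into each other, so it suffices to place each variable
  -- in the span of its degree.
  have : SetLike.GradedMonoid 𝒬 := by
    refine { one_mem := ?_, mul_mem := ?_ }
    · rw [h𝒬]
      exact Submodule.subset_span ⟨0, ⟨zero_mem _, rfl⟩, M.cls_zero V hw (by linarith)⟩
    · intro i j y z hy hz
      rw [h𝒬] at hy hz ⊢
      have := Submodule.mul_mem_mul hy hz
      rw [Submodule.span_mul_span] at this
      refine Submodule.span_mono ?_ this
      rintro _ ⟨_, ⟨x, hx, rfl⟩, _, ⟨x', hx', rfl⟩, rfl⟩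
      exact ⟨x + x', ⟨add_mem hx.1 hx'.1, by rw [Prod.fst_add, hx.2, hx'.2]⟩,
        M.cls_add V hw hB hx.1 hx'.1⟩
  have hX : ∀ j, Ideal.Quotient.mkₐ K J (X j) ∈ 𝒬 (deg j) := by
    intro j
    have h1 : w j ∈ (𝒰 (deg j)).map (aeval w : MvPolynomial (Fin r) K →ₐ[K] R).toLinearMap := by
      rw [Submodule.map_span, Set.image_image]
      simp only [AlgHom.toLinearMap_apply, M.aeval_lift V hw]
      exact M.le_span _ (hw.1 j)
    obtain ⟨t, ht, htw⟩ := h1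
    refine ⟨t, ht, ?_⟩
    have h2 : 𝒰 (deg j) ≤ weightedHomogeneousSubmodule K deg (deg j) := by
      refine Submodule.span_le.2 ?_
      rintro _ ⟨x, hx, rfl⟩
      exact hx.2 ▸ M.isWeightedHomogeneous_lift V hw x
    -- A generator and a combination of lifts with the same value differ by a relation of degree
    -- `deg j ≤ N ≤ B`.
    refine mk_eq_mk_of_low (e := deg j) ?_ (h2 ht) (isWeightedHomogeneous_X K deg j) ?_
    · have : (deg j : ℚ) ≤ ((∑ i, ℓ i * a i : ℕ) : ℚ) := by exact_mod_cast hdeg j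
      linarith
    · rw [aeval_X]
      exact htw
  have hmem := aeval_mem_of_isWeightedHomogeneous hX hp
  have hcomp : (aeval fun j => Ideal.Quotient.mkₐ K J (X j)) = Ideal.Quotient.mkₐ K J := by
    ext j
    simp
  rw [hcomp] at hmem
  obtain ⟨t, ht, htp⟩ := hmem
  -- The base point `-⌊d α_i⌋` is the least exponent vector allowed by the slacks, so every exponent
  -- of degree `d` is a translate of it by natural numbers.
  have h3 : 𝒰 d ≤ (restrictSupport K
      {e : ι →₀ ℕ | shift (d, -fun i => ⌊d * α i⌋) e ∈ exponents α a}).map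
      (shiftSum (M.lift V hw) (d, -fun i => ⌊d * α i⌋)) := by
    refine Submodule.span_le.2 ?_
    rintro _ ⟨⟨d', c⟩, ⟨hx, rfl⟩, rfl⟩
    have hnn : ∀ i, 0 ≤ c i + ⌊d' * α i⌋ := by
      intro i
      have h1 : (0 : ℚ) ≤ c i + d' * α i := hx.1 i
      have h2 : -c i ≤ ⌊d' * α i⌋ := by
        rw [Int.le_floor]
        push_cast
        linarith
      linarith
    let e : ι →₀ ℕ := Finsupp.equivFunOnFinite.symm fun i => (c i + ⌊d' * α i⌋).toNat
    have he : shift ((d', -fun i => ⌊d' * α i⌋) : ℕ × (ι → ℤ)) e = (d', c) := by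
      refine Prod.ext (fst_shift _ _) (funext fun i => ?_)
      simp [shift, e, max_eq_left (hnn i)]
    refine ⟨monomial e 1, ?_, ?_⟩
    · rw [SetLike.mem_coe, mem_restrictSupport_iff]
      intro e' he'
      obtain rfl : e' = e := by simpa using support_monomial_subset he'
      rw [Set.mem_ofPred_eq, he]
      exact hx
    · rw [shiftSum_monomial, he, one_smul]
  obtain ⟨q, hq, hqt⟩ := h3 ht
  refine ⟨q, fun e he => ?_, ?_⟩
  · rw [SetLike.mem_coe, mem_restrictSupport_iff] at hq
    exact hq he
  · rw [hqt]
    exact htp.symm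

include M V in
/-- The relations are generated in degrees at most any bound for both the relations between lifts of
monomials and the relations between the `f_i`. -/
theorem relationsGeneratedInDegreesLE (hw : IsHomogeneousGeneratingSystem 𝒜 deg w)
    (hdeg : ∀ j, deg j ≤ ∑ i, ℓ i * a i) (hB : 2 * ((∑ i, ℓ i * a i : ℕ) : ℚ) ≤ B)
    (hBa : ∀ i, (a i : ℚ) / (∑ j, α j * a j) + ((∑ j, ℓ j * a j : ℕ) : ℚ) ≤ B)
    {g : ι → MvPolynomial ι K} (hg : ∀ i, IsWeightedHomogeneous a (X i - g i) (a i))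
    (hfg : ∀ i, aeval f (X i - g i) = 0)
    (hker : ∀ q : MvPolynomial ι K, aeval f q = 0 →
      q ∈ Ideal.span (Set.range fun i => X i - g i)) :
    RelationsGeneratedInDegreesLE (K := K) deg w B := by
  have hle : lowRelations deg w B ≤ RingHom.ker (aeval w : MvPolynomial (Fin r) K →ₐ[K] R) :=
    Ideal.span_le.2 fun p hp => hp.1
  have hhom : ∀ (d : ℕ) (p : MvPolynomial (Fin r) K), IsWeightedHomogeneous deg p d →
      aeval w p = 0 → p ∈ lowRelations deg w B := by
    intro d p hp hp0
    obtain ⟨q, hq, hpq⟩ := M.exists_mk_eq_shiftSum V hw hdeg hB hp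
    -- Applying the evaluation to the congruence turns `p ↦ 0` into `q(f) = 0`, a relation among the
    -- `f_i` only.
    have h1 := hle (Ideal.Quotient.eq.1 hpq)
    have h2 := map_shiftSum (aeval w : MvPolynomial (Fin r) K →ₐ[K] R).toLinearMap
      (M.lift V hw) (d, -fun i => ⌊d * α i⌋) q
    simp only [AlgHom.toLinearMap_apply, M.aeval_lift V hw] at h2
    rw [RingHom.mem_ker, map_sub, hp0, h2, zero_sub, neg_eq_zero,
      M.shiftSum_eq_zero_iff _ _ hq] at h1
    have hx : ((d, -fun i => ⌊d * α i⌋) : ℕ × (ι → ℤ)) ∈ slackCone α := fun i => by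
      simp [slack, Int.floor_le]
    have h3 := shiftSum_eq_zero_of_mem_span (M.cls V hw B) (C := slackCone α)
      (fun x hx e => shift_mem_slackCone hx e) (fun x hx p hp => by
        obtain ⟨i, rfl⟩ := hp
        have : Nonempty ι := ⟨i⟩
        exact M.shiftSum_cls_eq_zero V hw hB (hBa i) (hg i) (hfg i) hx) (hker q h1) hx
    have h4 := map_shiftSum (Ideal.Quotient.mkₐ K (lowRelations deg w B)).toLinearMap
      (M.lift V hw) (d, -fun i => ⌊d * α i⌋) q
    rw [← Ideal.Quotient.eq_zero_iff_mem]
    exact hpq.trans (h4.trans h3)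
  refine le_antisymm (fun p hp => ?_) hle
  change p ∈ lowRelations deg w B
  rw [← sum_weightedHomogeneousComponent deg p,
    finsum_eq_sum _ (weightedHomogeneousComponent_finsupp p)]
  refine sum_mem fun d _ => hhom d _ (weightedHomogeneousComponent_isWeightedHomogeneous d p) ?_
  rw [M.aeval_weightedHomogeneousComponent hw.1, hp]
  rw [hp]
  exact zero_mem _

end Relations

end MonomialGrading

end ProjDiv

end

/-! ### The monomial grading of the canonical ring -/

noncomputable section

namespace ProjDiv

variable {K : Type*} [Field K] {m : ℕ}

namespace canonicalRing

variable {D : QDivisor K m}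

/-- The element `u ^ d g` of the canonical ring. -/
def ofH0 (d : ℕ) (g : FracRing K m) (hg : g ∈ H0 ((d : ℚ) • D).floor) : canonicalRing D :=
  ⟨Polynomial.monomial d g, fun e => by
    rw [Polynomial.coeff_monomial]
    split_ifs with h
    · exact h ▸ hg
    · exact zero_mem _⟩

theorem ofH0_mem {d : ℕ} {g : FracRing K m} (hg : g ∈ H0 ((d : ℚ) • D).floor) :
    ofH0 d g hg ∈ component D d := fun e he => by
  simp [ofH0, Polynomial.coeff_monomial_of_ne _ he]

theorem coe_eq_monomial {d : ℕ} {y : canonicalRing D} (hy : y ∈ component D d) :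
    (y : Polynomial (FracRing K m)) =
      Polynomial.monomial d ((y : Polynomial (FracRing K m)).coeff d) := by
  ext e
  by_cases h : e = d
  · rw [h, Polynomial.coeff_monomial_same]
  · rw [hy e h, Polynomial.coeff_monomial_of_ne _ h]

theorem gradedMonoid (D : QDivisor K m) : SetLike.GradedMonoid (component D) where
  one_mem := fun e he => by
    rw [OneMemClass.coe_one, Polynomial.coeff_one, if_neg he]
  mul_mem := by
    intro i j y z hy hz e he
    rw [MulMemClass.coe_mul, coe_eq_monomial hy, coe_eq_monomial hz,
      Polynomial.monomial_mul_monomial, Polynomial.coeff_monomial_of_ne _ he]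

theorem independent (s : Finset ℕ) (y : ℕ → canonicalRing D) (hy : ∀ d, y d ∈ component D d)
    (hsum : ∑ d ∈ s, y d = 0) : ∀ d ∈ s, y d = 0 := by
  intro d hd
  have h := congrArg (fun z : canonicalRing D => (z : Polynomial (FracRing K m)).coeff d) hsum
  simp only [AddSubmonoidClass.coe_finsetSum, Polynomial.finsetSum_coeff, ZeroMemClass.coe_zero,
    Polynomial.coeff_zero] at h
  rw [Finset.sum_eq_single d (fun e _ he => hy e d he.symm) (fun h => absurd hd h)] at h
  apply Subtype.ext
  rw [coe_eq_monomial (hy d), h, map_zero]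
  rfl

theorem iSup_component (D : QDivisor K m) : ⨆ d, component D d = ⊤ := by
  rw [eq_top_iff]
  intro y _
  have h : y = ∑ d ∈ (y : Polynomial (FracRing K m)).support,
      ofH0 d ((y : Polynomial (FracRing K m)).coeff d) (y.2 d) := by
    apply Subtype.ext
    rw [AddSubmonoidClass.coe_finsetSum]
    exact (y : Polynomial (FracRing K m)).as_sum_support
  rw [h]
  exact sum_mem fun d _ => Submodule.mem_iSup_of_mem d (ofH0_mem _)

variable {ι : Type*} [Fintype ι] {P : ι → PrimeDivisor K m} {f : ι → CoordRing K m}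
  (hf : ∀ i, (P i).IsDefinedBy (f i)) (hP : Function.Injective P) {α : ι → ℚ}
  (hD : D = ∑ i, Finsupp.single (P i) (α i))

open Classical in
/-- The element `u ^ d ∏ f_i ^ c_i` of the canonical ring. -/
def mono (x : ℕ × (ι → ℤ)) : canonicalRing D :=
  if hx : x ∈ exponents α fun i => (P i).degree then
    ofH0 x.1 (monomialFraction f x.2) (monomialFraction_mem_H0 hf hP hD hx.1 hx.2) else 0

theorem mono_of_mem {x : ℕ × (ι → ℤ)} (hx : x ∈ exponents α fun i => (P i).degree) :
    mono hf hP hD x =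
      ofH0 x.1 (monomialFraction f x.2) (monomialFraction_mem_H0 hf hP hD hx.1 hx.2) :=
  dif_pos hx

/-- All terms share the factor `u ^ d ∏ f_i ^ c_i`, which is nonzero; so linear relations among
monomials of one degree are exactly relations `q(f) = 0`. -/
theorem coe_shiftSum_mono {x : ℕ × (ι → ℤ)} {q : MvPolynomial ι K}
    (hq : ∀ e ∈ q.support, shift x e ∈ exponents α fun i => (P i).degree) :
    (shiftSum (mono hf hP hD) x q : Polynomial (FracRing K m)) = Polynomial.monomial x.1
      (monomialFraction f x.2 * algebraMap _ (FracRing K m) (aeval f q)) := by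
  have h1 : ∀ e ∈ q.support, (mono hf hP hD (shift x e) : Polynomial (FracRing K m)) =
      Polynomial.monomial x.1 (monomialFraction f x.2 *
        algebraMap _ (FracRing K m) (aeval f (monomial e (1 : K)))) := by
    intro e he
    rw [mono_of_mem hf hP hD (hq e he), ← monomialFraction_natCast, ← monomialFraction_add hf]
    change Polynomial.monomial (shift x e).1 _ = _
    rw [fst_shift]
    rfl
  rw [shiftSum_apply, AddSubmonoidClass.coe_finsetSum]
  conv_rhs => rw [q.as_sum, map_sum, map_sum, Finset.mul_sum, map_sum]
  refine Finset.sum_congr rfl fun e he => ?_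
  have h2 : (monomial e (coeff e q) : MvPolynomial ι K) = coeff e q • monomial e (1 : K) := by
    rw [smul_monomial, smul_eq_mul, mul_one]
  rw [Subalgebra.coe_smul, h1 e he, h2, map_smul, Polynomial.smul_monomial]
  congr 1
  rw [Algebra.smul_def (coeff e q) (aeval f (monomial e (1 : K))), map_mul,
    ← IsScalarTower.algebraMap_apply K (CoordRing K m) (FracRing K m), Algebra.smul_def]
  ring

/-- After clearing poles, the section `φ` writes the remaining form as a polynomial in the `f_i` of
the right weight, so that each of its terms gives an element of `exponents`. -/
theorem component_le_span {i₀ : ι} (hi₀ : (f i₀).IsHomogeneous 1)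
    {φ : CoordRing K m →ₐ[K] MvPolynomial ι K} (hφ : ∀ h, aeval f (φ h) = h)
    (hφ' : ∀ (h : CoordRing K m) (e : ℕ), h.IsHomogeneous e →
      IsWeightedHomogeneous (fun i => (P i).degree) (φ h) e) (d : ℕ) :
    component D d ≤ Submodule.span K (mono hf hP hD ''
      {x | x ∈ (exponents α fun i => (P i).degree) ∧ x.1 = d}) := by
  intro y hy
  by_cases hg0 : (y : Polynomial (FracRing K m)).coeff d = 0
  · have : y = 0 := by
      apply Subtype.ext
      rw [coe_eq_monomial hy, hg0, map_zero]
      rfl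
    rw [this]
    exact zero_mem _
  obtain ⟨q, e, hq, he, heq⟩ := exists_of_mem_H0 hf hP hD hi₀ (y.2 d) hg0
  have hgood : ∀ e' ∈ (φ q).support, shift ((d, -fun i => ⌊d * α i⌋) : ℕ × (ι → ℤ)) e' ∈
      exponents α fun i => (P i).degree := by
    intro e' he'
    refine ⟨shift_mem_slackCone (fun i => by simp [slack, Int.floor_le]) e', ?_⟩
    have h := hφ' q e hq (mem_support_iff.1 he')
    rw [Finsupp.weight_apply, Finsupp.sum_fintype _ _ (by simp)] at h
    rw [← h] at he
    push_cast at he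
    simp only [smul_eq_mul, Nat.cast_mul] at he
    simp [shift, add_mul, Finset.sum_add_distrib, he]
  have hy' : y = shiftSum (mono hf hP hD) (d, -fun i => ⌊d * α i⌋) (φ q) := by
    apply Subtype.ext
    rw [coe_shiftSum_mono hf hP hD hgood, hφ, ← heq]
    exact coe_eq_monomial hy
  rw [hy', shiftSum_apply]
  refine sum_mem fun e' he' => Submodule.smul_mem _ _ (Submodule.subset_span ?_)
  exact ⟨_, ⟨hgood e' he', fst_shift _ _⟩, rfl⟩

/-- The canonical ring is graded by the monomials in the equations of the components of `D`. -/
def monomialGrading {i₀ : ι} (hi₀ : (f i₀).IsHomogeneous 1)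
    {φ : CoordRing K m →ₐ[K] MvPolynomial ι K} (hφ : ∀ h, aeval f (φ h) = h)
    (hφ' : ∀ (h : CoordRing K m) (e : ℕ), h.IsHomogeneous e →
      IsWeightedHomogeneous (fun i => (P i).degree) (φ h) e) :
    MonomialGrading (K := K) (R := canonicalRing D) α (fun i => (P i).degree) (component D)
      f where
  mono := mono hf hP hD
  mono_zero := by
    rw [mono_of_mem hf hP hD (zero_mem _)]
    apply Subtype.ext
    change Polynomial.monomial 0 (monomialFraction f 0) = 1
    rw [monomialFraction_zero, Polynomial.monomial_zero_one]
  mono_add := by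
    intro x y hx hy
    rw [mono_of_mem hf hP hD hx, mono_of_mem hf hP hD hy, mono_of_mem hf hP hD (add_mem hx hy)]
    apply Subtype.ext
    change Polynomial.monomial (x.1 + y.1) (monomialFraction f (x.2 + y.2)) =
      Polynomial.monomial x.1 (monomialFraction f x.2) *
        Polynomial.monomial y.1 (monomialFraction f y.2)
    rw [Polynomial.monomial_mul_monomial, monomialFraction_add hf]
  mono_of_notMem hx := dif_neg hx
  mono_mem hx := by
    rw [mono_of_mem hf hP hD hx]
    exact ofH0_mem _
  le_span := component_le_span hf hP hD hi₀ hφ hφ'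
  graded := gradedMonoid D
  independent := independent
  iSup_eq_top := iSup_component D
  shiftSum_eq_zero_iff x q hq := by
    rw [← ZeroMemClass.coe_eq_zero, coe_shiftSum_mono hf hP hD hq, Polynomial.monomial_eq_zero_iff,
      mul_eq_zero, or_iff_right (monomialFraction_ne_zero hf _),
      map_eq_zero_iff _ (IsFractionRing.injective (CoordRing K m) (FracRing K m))]

end canonicalRing

/-- The kernel of an evaluation with a section is generated by the differences between the variables
and their images. -/
theorem mem_span_of_aeval_eq_zero {ι S : Type*} [CommRing S] [Algebra K S] {f : ι → S}
    {φ : S →ₐ[K] MvPolynomial ι K} {q : MvPolynomial ι K} (hq : aeval f q = 0) :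
    q ∈ Ideal.span (Set.range fun i => X i - φ (f i)) := by
  set I := Ideal.span (Set.range fun i => X i - φ (f i)) with hI
  -- Modulo `I` each `y_i` equals `φ(f_i)`, so `q` is congruent to `φ(q(f))`.
  have h : (Ideal.Quotient.mkₐ K I).comp (φ.comp (aeval f)) = Ideal.Quotient.mkₐ K I := by
    ext i
    simp only [AlgHom.comp_apply, aeval_X]
    have hi : X i - φ (f i) ∈ I := Ideal.subset_span ⟨i, rfl⟩
    exact (Ideal.Quotient.eq.2 hi).symm
  have h1 := DFunLike.congr_fun h q
  simp only [AlgHom.comp_apply, hq, map_zero] at h1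
  exact Ideal.Quotient.eq_zero_iff_mem.1 h1.symm

end ProjDiv

end

/-! ### The degree bounds -/

theorem theorem1p3 {K : Type*} [Field K] {m n : ℕ}
    (P : Fin (n + 1) → ProjDiv.PrimeDivisor K m) (hP : Function.Injective P)
    (f : Fin (n + 1) → MvPolynomial (Fin (m + 1)) K) (hf : ∀ i, (P i).IsDefinedBy (f i))
    (hlin : ∃ s : Fin (m + 1) → Fin (n + 1),
      (∀ j, (f (s j)).IsHomogeneous 1) ∧ LinearIndependent K (fun j => f (s j)))
    (α : Fin (n + 1) → ℚ) (D : ProjDiv.QDivisor K m)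
    (hD : D = ∑ i, Finsupp.single (P i) (α i)) (hdeg : 0 < ProjDiv.QDivisor.degree D) :
    let a : Fin (n + 1) → ℕ := fun i => (P i).degree
    let ℓ : Fin (n + 1) → ℕ := fun i => (Finset.univ.erase i).lcm fun j => (α j).den
    let N : ℕ := ∑ i, ℓ i * a i
    let B : ℚ := max (2 * (N : ℚ))
      (((Finset.univ.sup' Finset.univ_nonempty a : ℕ) : ℚ) / ProjDiv.QDivisor.degree D + N)
    (∃ (r : ℕ) (deg : Fin r → ℕ) (w : Fin r → ProjDiv.canonicalRing D), (∀ j, deg j ≤ N) ∧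
      ProjDiv.IsHomogeneousGeneratingSystem (ProjDiv.canonicalRing.component D) deg w) ∧
    ∀ (r : ℕ) (deg : Fin r → ℕ) (w : Fin r → ProjDiv.canonicalRing D), (∀ j, deg j ≤ N) →
      ProjDiv.IsHomogeneousGeneratingSystem (ProjDiv.canonicalRing.component D) deg w →
      ProjDiv.RelationsGeneratedInDegreesLE (K := K) deg w B := by
  classical
  intro a ℓ N B
  obtain ⟨s, hs, hli⟩ := hlin
  have ha1 : ∀ j, a (s j) = 1 := fun j =>
    (hf (s j)).isHomogeneous.inj_right (hs j) (hf (s j)).prime.ne_zero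
  obtain ⟨φ, hφ, hφ'⟩ := ProjDiv.exists_section (a := a) hs ha1 hli
  have hΔ := ProjDiv.qDivisor_degree_eq hD
  obtain ⟨V⟩ := ProjDiv.exists_raySystem (α := α) (a := a) (fun i => (P i).degree_pos)
    (hΔ ▸ hdeg)
  let M := ProjDiv.canonicalRing.monomialGrading hf hP hD (hs 0) hφ hφ'
  refine ⟨M.exists_isHomogeneousGeneratingSystem V, fun r deg w hle hw => ?_⟩
  -- The kernel generators `y_i - φ(f_i)` have weight `a_i`; they are the source of `max a_i / deg
  -- D` in `B`.
  refine M.relationsGeneratedInDegreesLE V hw hle (le_max_left _ _) (fun i => ?_)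
    (g := fun i => φ (f i)) (fun i => ?_) (fun i => ?_)
    fun q hq => ProjDiv.mem_span_of_aeval_eq_zero hq
  · refine le_trans ?_ (le_max_right _ _)
    rw [← hΔ]
    have hi : a i ≤ Finset.univ.sup' Finset.univ_nonempty a :=
      Finset.le_sup' a (Finset.mem_univ i)
    gcongr
  · exact (MvPolynomial.isWeightedHomogeneous_X K a i).sub (hφ' _ _ (hf i).isHomogeneous)
  · rw [map_sub, MvPolynomial.aeval_X, hφ, sub_self]
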